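/- **Notation.** Let $s>1$, $q\in[1,\infty]$. For a compact $K\subset\mathbf R^d$, $A>0$ and $\varphi\in C^\infty(\mathbf R^d)$ put $\|\varphi\|_{s,A,K}=\sup_{\beta\in\mathbf N^d}\sup_{x\in K}\frac{A^{|\beta|}}{(\beta!)^s}|\varphi^{(\beta)}(x)|$. Let $\mathcal E^{\{s\}}(\mathbf R^d)=\operatorname{proj\,lim}_{K}\operatorname{ind\,lim}_{A\to0}\mathcal E^s_{A,K}$ be the space of all $\varphi\in C^\infty(\mathbf R^d)$ such that for every compact $K$ there is $A>0$ with $\|\varphi\|_{s,A,K}<\infty$, and let $(\mathcal E^{\{s\}})'(\mathbf R^d)$ be its dual: the linear functionals $f$ on $\mathcal E^{\{s\}}(\mathbf R^d)$ for which there is a compact $K$ such that for every $A>0$ there is $C$ with $|\langle f,\varphi\rangle|\le C\|\varphi\|_{s,A,K}$ for all $\varphi$. The support of $f$ is the complement of the largest open set on which $f$ vanishes, and $\widehat f(\xi)=(2\pi)^{-d/2}\langle f,e^{-i\langle\cdot,\xi\rangle}\rangle$. Let $\mathscr M_{\{s\}}(\mathbf R^n)$ be the set of all functions $\omega\ge0$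 on $\mathbf R^n$ for which there are a constant $C>0$ and a submultiplicative $v\ge0$ with $\omega(x+y)\le C\,v(x)\omega(y)$ for all $x,y$, such that $v\le C'e^{k|\cdot|^{1/s}}$ for some $C',k>0$. For $\omega\in\mathscr M_{\{s\}}(\mathbf R^d)$, an open set $\Gamma\subseteq\mathbf R^d$, and a discrete set $H\subset\mathbf R^d$ let $$|f|_{\mathscr FL^{q,\Gamma}_{(\omega)}}=\Big(\int_\Gamma|\widehat f(\xi)\omega(\xi)|^q\,d\xi\Big)^{1/q},\qquad |f|^{(D)}_{\mathscr FL^{q}_{(\omega)}(H)}=\Big(\sum_{\xi\in H}|\widehat f(\xi)\omega(\xi)|^q\Big)^{1/q},$$ with the essential supremum and the supremum instead when $q=\infty$. A lattice is a set $\Lambda=\{\sum_j a_je_j:\ a_j\in\mathbf Z\}$ where $e_1,\dots,e_d$ is a basis of $\mathbf R^d$ (then called a basis for $\Lambda$). A pair of lattices $(\Lambda_1,\Lambda_2)$ is *admissible* if there are bases $e_1,\dots,e_d$ for $\Lambda_1$ and $\varepsilon_1,\dots,\varepsilon_d$ for $\Lambda_2$ and a number $0<c\le2\pi$ with $\langle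 e_j,\varepsilon_j\rangle=c$ for all $j$ and $\langle e_j,\varepsilon_k\rangle=0$ for $j\ne k$. A $\Lambda$-parallelepiped is a set $\{x_0+\sum_jt_je_j:\ t_j\in[0,1]\}$ with $x_0\in\Lambda$ and $e_1,\dots,e_d$ some basis for $\Lambda$. An open cone is an open subset of $\mathbf R^d$ that is stable under multiplication by positive numbers. **Lemma.** Let $s>1$, $q\in[1,\infty]$, let $(\Lambda_1,\Lambda_2)$ be an admissible lattice pair in $\mathbf R^d$, let $D_1$ be a $\Lambda_1$-parallelepiped, and let $f\in(\mathcal E^{\{s\}})'(\mathbf R^d)$ be such that an open neighbourhood of its support is contained in $D_1$. Let $\Gamma_0$ and $\Gamma$ be open cones such that the closure of $\Gamma_0$ in $\mathbf R^d\setminus\{0\}$ is contained in $\Gamma$. 1. For every $\omega\in\mathscr M_{\{s\}}(\mathbf R^d)$: if $|f|^{(D)}_{\mathscr FL^q_{(\omega)}(\Gamma\cap\Lambda_2)}<\infty$, then $|f|_{\mathscr FL^{q,\Gamma_0}_{(\omega)}}<\infty$. 2. The same holds for every $\omega\in\mathscr M_{\{s\}}(\mathbf R^{2d})$ and every $x\in\mathbf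 R^d$, with $\omega(x,\cdot)$ in place of $\omega$ in both semi-norms. -/

import Mathlib

open scoped ENNReal NNReal

/-- The partial derivative of `φ` in the `i`-th coordinate direction. -/
noncomputable def partialDeriv {d : ℕ} (i : Fin d) (φ : EuclideanSpace ℝ (Fin d) → ℂ) :
    EuclideanSpace ℝ (Fin d) → ℂ :=
  fun x => fderiv ℝ φ x (EuclideanSpace.single i 1)

/-- The derivatives `∂_i ^ (β i)` for the coordinates `i` in the list `l`, the head of the list
being applied last. -/
noncomputable def listDeriv {d : ℕ} (β : Fin d → ℕ) (l : List (Fin d))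
    (φ : EuclideanSpace ℝ (Fin d) → ℂ) : EuclideanSpace ℝ (Fin d) → ℂ :=
  l.foldr (fun i g => (partialDeriv i)^[β i] g) φ

/-- The derivative `φ^(β) = ∂_1^{β_1} ⋯ ∂_d^{β_d} φ` for a multi-index `β`. -/
noncomputable def multiDeriv {d : ℕ} (β : Fin d → ℕ) (φ : EuclideanSpace ℝ (Fin d) → ℂ) :
    EuclideanSpace ℝ (Fin d) → ℂ :=
  listDeriv β (List.finRange d) φ

/-- The norm `‖φ‖_{s,A,K} = sup_β sup_{x ∈ K} A^|β| / (β!)^s * |φ^(β)(x)|`, with values in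
`[0, ∞]`. -/
noncomputable def gevreyNorm {d : ℕ} (s A : ℝ) (K : Set (EuclideanSpace ℝ (Fin d)))
    (φ : EuclideanSpace ℝ (Fin d) → ℂ) : ℝ≥0∞ :=
  ⨆ β : Fin d → ℕ, ⨆ x ∈ K,
    ENNReal.ofReal (A ^ (∑ i, β i) / ((∏ i, (β i).factorial : ℕ) : ℝ) ^ s) * ‖multiDeriv β φ x‖ₑ

section helpers

variable {d : ℕ}

theorem contDiff_partialDeriv (i : Fin d) {φ : EuclideanSpace ℝ (Fin d) → ℂ}
    (h : ContDiff ℝ (⊤ : ℕ∞) φ) : ContDiff ℝ (⊤ : ℕ∞) (partialDeriv i φ) :=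
  (h.fderiv_right (m := ((⊤ : ℕ∞) : WithTop ℕ∞)) (by simp)).clm_apply contDiff_const

theorem contDiff_partialDeriv_iterate (i : Fin d) (n : ℕ) {φ : EuclideanSpace ℝ (Fin d) → ℂ}
    (h : ContDiff ℝ (⊤ : ℕ∞) φ) : ContDiff ℝ (⊤ : ℕ∞) ((partialDeriv i)^[n] φ) := by
  induction n with
  | zero => exact h
  | succ n ih => rw [Function.iterate_succ_apply']; exact contDiff_partialDeriv i ih

theorem partialDeriv_iterate_add (i : Fin d) (n : ℕ) {φ ψ : EuclideanSpace ℝ (Fin d) → ℂ}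
    (h : ContDiff ℝ (⊤ : ℕ∞) φ) (h' : ContDiff ℝ (⊤ : ℕ∞) ψ) :
    (partialDeriv i)^[n] (φ + ψ) = (partialDeriv i)^[n] φ + (partialDeriv i)^[n] ψ := by
  induction n with
  | zero => rfl
  | succ n ih =>
    simp only [Function.iterate_succ_apply', ih]
    funext x
    simp only [partialDeriv, Pi.add_apply]
    rw [fderiv_add ((contDiff_partialDeriv_iterate i n h).differentiable (by simp) x)
      ((contDiff_partialDeriv_iterate i n h').differentiable (by simp) x)]
    rfl

theorem partialDeriv_iterate_smul (i : Fin d) (n : ℕ) (c : ℂ)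
    {φ : EuclideanSpace ℝ (Fin d) → ℂ} (h : ContDiff ℝ (⊤ : ℕ∞) φ) :
    (partialDeriv i)^[n] (c • φ) = c • (partialDeriv i)^[n] φ := by
  induction n with
  | zero => rfl
  | succ n ih =>
    simp only [Function.iterate_succ_apply', ih]
    funext x
    simp only [partialDeriv, Pi.smul_apply]
    rw [fderiv_const_smul ((contDiff_partialDeriv_iterate i n h).differentiable (by simp) x)]
    rfl

theorem contDiff_listDeriv (β : Fin d → ℕ) (l : List (Fin d))
    {φ : EuclideanSpace ℝ (Fin d) → ℂ} (h : ContDiff ℝ (⊤ : ℕ∞) φ) :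
    ContDiff ℝ (⊤ : ℕ∞) (listDeriv β l φ) := by
  induction l with
  | nil => exact h
  | cons i l ih => exact contDiff_partialDeriv_iterate i (β i) ih

theorem listDeriv_add (β : Fin d → ℕ) (l : List (Fin d))
    {φ ψ : EuclideanSpace ℝ (Fin d) → ℂ} (h : ContDiff ℝ (⊤ : ℕ∞) φ) (h' : ContDiff ℝ (⊤ : ℕ∞) ψ) :
    listDeriv β l (φ + ψ) = listDeriv β l φ + listDeriv β l ψ := by
  induction l with
  | nil => rfl
  | cons i l ih =>
    change (partialDeriv i)^[β i] (listDeriv β l (φ + ψ)) = _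
    rw [ih, partialDeriv_iterate_add i _ (contDiff_listDeriv β l h) (contDiff_listDeriv β l h')]
    rfl

theorem listDeriv_smul (β : Fin d → ℕ) (l : List (Fin d)) (c : ℂ)
    {φ : EuclideanSpace ℝ (Fin d) → ℂ} (h : ContDiff ℝ (⊤ : ℕ∞) φ) :
    listDeriv β l (c • φ) = c • listDeriv β l φ := by
  induction l with
  | nil => rfl
  | cons i l ih =>
    change (partialDeriv i)^[β i] (listDeriv β l (c • φ)) = _
    rw [ih, partialDeriv_iterate_smul i _ c (contDiff_listDeriv β l h)]
    rfl

theorem gevreyNorm_add_le (s A : ℝ) (K : Set (EuclideanSpace ℝ (Fin d)))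
    {φ ψ : EuclideanSpace ℝ (Fin d) → ℂ} (h : ContDiff ℝ (⊤ : ℕ∞) φ) (h' : ContDiff ℝ (⊤ : ℕ∞) ψ) :
    gevreyNorm s A K (φ + ψ) ≤ gevreyNorm s A K φ + gevreyNorm s A K ψ := by
  refine iSup_le fun β => iSup₂_le fun x hx => ?_
  rw [multiDeriv, listDeriv_add β _ h h', Pi.add_apply]
  refine (mul_le_mul_right (enorm_add_le _ _) _).trans ?_
  rw [mul_add]
  refine add_le_add ?_ ?_
  · exact le_iSup_of_le β (le_iSup₂_of_le x hx le_rfl)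
  · exact le_iSup_of_le β (le_iSup₂_of_le x hx le_rfl)

theorem gevreyNorm_smul_le (s A : ℝ) (K : Set (EuclideanSpace ℝ (Fin d))) (c : ℂ)
    {φ : EuclideanSpace ℝ (Fin d) → ℂ} (h : ContDiff ℝ (⊤ : ℕ∞) φ) :
    gevreyNorm s A K (c • φ) ≤ ‖c‖ₑ * gevreyNorm s A K φ := by
  refine iSup_le fun β => iSup₂_le fun x hx => ?_
  rw [multiDeriv, listDeriv_smul β _ c h, Pi.smul_apply, enorm_smul, mul_left_comm]
  gcongr
  exact le_iSup_of_le β (le_iSup₂_of_le x hx le_rfl)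

theorem gevreyNorm_mono (s : ℝ) {A B : ℝ} (hA : 0 ≤ A) (hAB : A ≤ B)
    (K : Set (EuclideanSpace ℝ (Fin d))) (φ : EuclideanSpace ℝ (Fin d) → ℂ) :
    gevreyNorm s A K φ ≤ gevreyNorm s B K φ := by
  refine iSup_mono fun β => iSup₂_mono fun x _ => ?_
  gcongr

end helpers

/-- The Roumieu space `ℰ^{s}(ℝ^d)`: smooth functions `φ` such that for every compact `K` there is
some `A > 0` with `‖φ‖_{s,A,K} < ∞`. -/
def gevreySpace (d : ℕ) (s : ℝ) : Submodule ℂ (EuclideanSpace ℝ (Fin d) → ℂ) where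
  carrier := {φ | ContDiff ℝ (⊤ : ℕ∞) φ ∧
    ∀ K : Set (EuclideanSpace ℝ (Fin d)), IsCompact K → ∃ A : ℝ, 0 < A ∧ gevreyNorm s A K φ < ∞}
  add_mem' := by
    rintro φ ψ ⟨h, hK⟩ ⟨h', hK'⟩
    refine ⟨h.add h', fun K hc => ?_⟩
    obtain ⟨A, hA, hn⟩ := hK K hc
    obtain ⟨B, hB, hn'⟩ := hK' K hc
    refine ⟨min A B, lt_min hA hB, (gevreyNorm_add_le s _ K h h').trans_lt ?_⟩
    refine ENNReal.add_lt_top.2 ⟨?_, ?_⟩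
    · exact (gevreyNorm_mono s (lt_min hA hB).le (min_le_left _ _) K φ).trans_lt hn
    · exact (gevreyNorm_mono s (lt_min hA hB).le (min_le_right _ _) K ψ).trans_lt hn'
  zero_mem' := by
    refine ⟨contDiff_const, fun K _ => ⟨1, one_pos, ?_⟩⟩
    have h := gevreyNorm_smul_le s 1 K 0 (φ := (0 : EuclideanSpace ℝ (Fin d) → ℂ)) contDiff_const
    rw [smul_zero, enorm_zero, zero_mul] at h
    exact h.trans_lt ENNReal.zero_lt_top
  smul_mem' := by
    rintro c φ ⟨h, hK⟩
    refine ⟨contDiff_const.smul h, fun K hc => ?_⟩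
    obtain ⟨A, hA, hn⟩ := hK K hc
    exact ⟨A, hA, (gevreyNorm_smul_le s A K c h).trans_lt
      (ENNReal.mul_lt_top enorm_lt_top hn)⟩

/-- The function `x ↦ exp(-i⟨x, ξ⟩)`. -/
noncomputable def expFun {d : ℕ} (ξ : EuclideanSpace ℝ (Fin d)) :
    EuclideanSpace ℝ (Fin d) → ℂ :=
  fun x => Complex.exp (-Complex.I * ((inner ℝ x ξ : ℝ) : ℂ))

section helpers

variable {d : ℕ}

theorem contDiff_expFun (ξ : EuclideanSpace ℝ (Fin d)) : ContDiff ℝ (⊤ : ℕ∞) (expFun ξ) := by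
  have h : ContDiff ℝ (⊤ : ℕ∞) (fun x : EuclideanSpace ℝ (Fin d) => ((inner ℝ x ξ : ℝ) : ℂ)) :=
    Complex.ofRealCLM.contDiff.comp (contDiff_id.inner ℝ contDiff_const)
  exact (contDiff_const.mul h).cexp

theorem partialDeriv_expFun (i : Fin d) (ξ : EuclideanSpace ℝ (Fin d)) :
    partialDeriv i (expFun ξ) = (-Complex.I * (ξ i : ℂ)) • expFun ξ := by
  funext x
  have h1 : HasFDerivAt (fun x : EuclideanSpace ℝ (Fin d) => (inner ℝ x ξ : ℝ))
      (innerSL ℝ ξ) x := by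
    have h := (innerSL ℝ ξ).hasFDerivAt (x := x)
    refine h.congr_of_eventuallyEq (Filter.Eventually.of_forall fun y => ?_)
    simp [real_inner_comm]
  have h2 := ((Complex.ofRealCLM.hasFDerivAt.comp x h1).const_mul (-Complex.I)).cexp
  have h3 : fderiv ℝ (expFun ξ) x = _ := h2.fderiv
  simp only [partialDeriv, h3]
  simp [expFun, EuclideanSpace.inner_single_right]
  ring

theorem partialDeriv_iterate_expFun (i : Fin d) (n : ℕ) (ξ : EuclideanSpace ℝ (Fin d)) :
    (partialDeriv i)^[n] (expFun ξ) = (-Complex.I * (ξ i : ℂ)) ^ n • expFun ξ := by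
  induction n with
  | zero => simp
  | succ n ih =>
    rw [Function.iterate_succ_apply', ih]
    have h := partialDeriv_iterate_smul i 1 ((-Complex.I * (ξ i : ℂ)) ^ n) (contDiff_expFun ξ)
    simp only [Function.iterate_one] at h
    rw [h, partialDeriv_expFun, smul_smul, pow_succ]

theorem listDeriv_expFun (β : Fin d → ℕ) (l : List (Fin d)) (ξ : EuclideanSpace ℝ (Fin d)) :
    listDeriv β l (expFun ξ) =
      (l.map fun i => (-Complex.I * (ξ i : ℂ)) ^ β i).prod • expFun ξ := by
  induction l with
  | nil => simp [listDeriv]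
  | cons i l ih =>
    change (partialDeriv i)^[β i] (listDeriv β l (expFun ξ)) = _
    rw [ih, partialDeriv_iterate_smul i _ _ (contDiff_expFun ξ), partialDeriv_iterate_expFun,
      smul_smul, List.map_cons, List.prod_cons, mul_comm]

theorem norm_multiDeriv_expFun (β : Fin d → ℕ) (ξ x : EuclideanSpace ℝ (Fin d)) :
    ‖multiDeriv β (expFun ξ) x‖ = ∏ i, |ξ i| ^ β i := by
  have h : ‖expFun ξ x‖ = 1 := by
    rw [expFun, Complex.norm_exp]; simp
  rw [multiDeriv, listDeriv_expFun, Pi.smul_apply, norm_smul, h, mul_one]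
  rw [← List.ofFn_eq_map, List.prod_ofFn]
  simp [norm_prod]

theorem expFun_mem_gevreySpace {s : ℝ} (hs : 1 < s) (ξ : EuclideanSpace ℝ (Fin d)) :
    expFun ξ ∈ gevreySpace d s := by
  refine ⟨contDiff_expFun ξ, fun K _ => ?_⟩
  have hpos : 0 < 1 + ‖ξ‖ := by positivity
  refine ⟨(1 + ‖ξ‖)⁻¹, by positivity, lt_of_le_of_lt (b := 1) ?_ ENNReal.one_lt_top⟩
  refine iSup_le fun β => iSup₂_le fun x _ => ?_
  rw [← ofReal_norm, norm_multiDeriv_expFun, ← ENNReal.ofReal_mul (by positivity)]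
  refine ENNReal.ofReal_le_one.2 ?_
  have h1 : ∏ i, |ξ i| ^ β i ≤ (1 + ‖ξ‖) ^ (∑ i, β i) := by
    rw [← Finset.prod_pow_eq_pow_sum]
    refine Finset.prod_le_prod (fun i _ => by positivity) fun i _ => ?_
    have := PiLp.norm_apply_le ξ i
    rw [Real.norm_eq_abs] at this
    gcongr
    linarith
  have h2 : (1 : ℝ) ≤ ((∏ i, (β i).factorial : ℕ) : ℝ) ^ s := by
    refine Real.one_le_rpow ?_ (by linarith)
    exact_mod_cast Nat.one_le_iff_ne_zero.2
      (Finset.prod_ne_zero_iff.2 fun i _ => Nat.factorial_ne_zero _)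
  calc (1 + ‖ξ‖)⁻¹ ^ (∑ i, β i) / ((∏ i, (β i).factorial : ℕ) : ℝ) ^ s * ∏ i, |ξ i| ^ β i
      ≤ (1 + ‖ξ‖)⁻¹ ^ (∑ i, β i) * (1 + ‖ξ‖) ^ (∑ i, β i) := by
        gcongr
        exact div_le_self (by positivity) h2
    _ = 1 := by rw [← mul_pow, inv_mul_cancel₀ hpos.ne', one_pow]

end helpers

/-- The space `(ℰ^{s})'(ℝ^d)` of compactly supported Roumieu ultradistributions: linear functionals
on `ℰ^{s}(ℝ^d) = proj lim_K ind lim_{A → 0} ℰ^s_{A,K}` which are continuous, that is, for some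
compact `K` bounded with respect to each of the norms `‖·‖_{s,A,K}`, `A > 0`. -/
structure GevreyDual (d : ℕ) (s : ℝ) where
  toLinearMap : gevreySpace d s →ₗ[ℂ] ℂ
  continuous' : ∃ K : Set (EuclideanSpace ℝ (Fin d)), IsCompact K ∧
    ∀ A : ℝ, 0 < A → ∃ C : ℝ≥0, ∀ φ : gevreySpace d s,
      ‖toLinearMap φ‖ₑ ≤ C * gevreyNorm s A K (φ : EuclideanSpace ℝ (Fin d) → ℂ)

/-- The support of an ultradistribution: the complement of the largest open set on which it
vanishes, tested with functions in `𝒟^{s}(U)`. -/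
def GevreyDual.support {d : ℕ} {s : ℝ} (f : GevreyDual d s) : Set (EuclideanSpace ℝ (Fin d)) :=
  {x | ∀ U : Set (EuclideanSpace ℝ (Fin d)), IsOpen U → x ∈ U →
    ∃ φ : gevreySpace d s, HasCompactSupport (φ : EuclideanSpace ℝ (Fin d) → ℂ) ∧
      tsupport (φ : EuclideanSpace ℝ (Fin d) → ℂ) ⊆ U ∧ f.toLinearMap φ ≠ 0}

/-- The Fourier transform of a compactly supported ultradistribution,
`f̂(ξ) = (2π)^{-d/2} ⟨f, exp(-i⟨·, ξ⟩)⟩`, a function on `ℝ^d`. -/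
noncomputable def GevreyDual.fourier {d : ℕ} {s : ℝ} (hs : 1 < s) (f : GevreyDual d s)
    (ξ : EuclideanSpace ℝ (Fin d)) : ℂ :=
  (((2 * Real.pi) ^ (-(d : ℝ) / 2) : ℝ) : ℂ) *
    f.toLinearMap ⟨expFun ξ, expFun_mem_gevreySpace hs ξ⟩

/-- `ω` is a weight in `ℳ_{s}(V)`: it is non-negative and moderate with respect to a
submultiplicative weight `v` such that `v ≤ C exp(k |·|^{1/s})` for some `C, k > 0`. -/
def IsModerateWeight {V : Type*} [NormedAddCommGroup V] (s : ℝ) (ω : V → ℝ) : Prop :=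
  (∀ x, 0 ≤ ω x) ∧ ∃ v : V → ℝ, (∀ x, 0 ≤ v x) ∧ (∀ x y, v (x + y) ≤ v x * v y) ∧
    (∃ C k : ℝ, 0 < C ∧ 0 < k ∧ ∀ x, v x ≤ C * Real.exp (k * ‖x‖ ^ (1 / s))) ∧
    ∃ C : ℝ, 0 < C ∧ ∀ x y, ω (x + y) ≤ C * v x * ω y

/-- The semi-norm `(∫_Γ |f̂(ξ) ω(ξ)|^q dξ)^{1/q}`, the essential supremum over `Γ` if `q = ∞`. -/
noncomputable def contSeminorm {d : ℕ} {s : ℝ} (hs : 1 < s) (q : ℝ≥0∞)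
    (ω : EuclideanSpace ℝ (Fin d) → ℝ) (Γ : Set (EuclideanSpace ℝ (Fin d)))
    (f : GevreyDual d s) : ℝ≥0∞ :=
  MeasureTheory.eLpNorm (fun ξ => f.fourier hs ξ * (ω ξ : ℂ)) q
    (MeasureTheory.volume.restrict Γ)

/-- The semi-norm `(∑_{ξ ∈ H} |f̂(ξ) ω(ξ)|^q)^{1/q}`, the supremum over `H` if `q = ∞`. -/
noncomputable def discSeminorm {d : ℕ} {s : ℝ} (hs : 1 < s) (q : ℝ≥0∞)
    (ω : EuclideanSpace ℝ (Fin d) → ℝ) (H : Set (EuclideanSpace ℝ (Fin d)))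
    (f : GevreyDual d s) : ℝ≥0∞ :=
  if q = ∞ then ⨆ ξ ∈ H, ‖f.fourier hs ξ * (ω ξ : ℂ)‖ₑ
  else (∑' ξ : H, ‖f.fourier hs (ξ : EuclideanSpace ℝ (Fin d)) * (ω ξ : ℂ)‖ₑ ^ q.toReal) ^
    (1 / q.toReal)

/-- An open cone in `ℝ^d`: an open set that is stable under multiplication by positive numbers. -/
def IsOpenCone {d : ℕ} (Γ : Set (EuclideanSpace ℝ (Fin d))) : Prop :=
  IsOpen Γ ∧ ∀ t : ℝ, 0 < t → ∀ ξ ∈ Γ, t • ξ ∈ Γ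

/-- The basis `e` of `ℝ^d` is a basis for the lattice `Λ`: `Λ = {∑ a_j e_j ; a_j ∈ ℤ}`. -/
def IsLatticeBasis {d : ℕ} (Λ : Submodule ℤ (EuclideanSpace ℝ (Fin d)))
    (e : Module.Basis (Fin d) ℝ (EuclideanSpace ℝ (Fin d))) : Prop :=
  Λ = Submodule.span ℤ (Set.range e)

/-- `(Λ₁, Λ₂)` is an admissible lattice pair. -/
def IsAdmissibleLatticePair {d : ℕ} (Λ₁ Λ₂ : Submodule ℤ (EuclideanSpace ℝ (Fin d))) : Prop :=
  ∃ e ε : Module.Basis (Fin d) ℝ (EuclideanSpace ℝ (Fin d)),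
    IsLatticeBasis Λ₁ e ∧ IsLatticeBasis Λ₂ ε ∧
    ∃ c : ℝ, 0 < c ∧ c ≤ 2 * Real.pi ∧
      ∀ j k, inner ℝ (e j) (ε k) = if j = k then c else 0

/-- `D` is a `Λ`-parallelepiped: `D = {x₀ + ∑ t_j e_j ; t_j ∈ [0, 1]}` for some `x₀ ∈ Λ` and some
basis `e` for `Λ`. -/
def IsLatticeParallelepiped {d : ℕ} (Λ : Submodule ℤ (EuclideanSpace ℝ (Fin d)))
    (D : Set (EuclideanSpace ℝ (Fin d))) : Prop :=
  ∃ x₀ ∈ Λ, ∃ e : Module.Basis (Fin d) ℝ (EuclideanSpace ℝ (Fin d)), IsLatticeBasis Λ e ∧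
    D = (fun y => x₀ + y) '' parallelepiped e

/-! The edges of `D₁` form a basis of `Λ₁`; let `ε'` be its dual basis multiplied by `c`, and let
`λ_n` be the points of the lattice it spans. All of them lie in `Λ₂` (`latticePoint_mem_of_dual`).
Since `c ≤ 2π`, the support of `f` lies inside a single period cell of the characters
`e^{-i⟨x,λ_n⟩}`. Hence `e^{-i⟨x,ξ⟩}`, multiplied by a window equal to 1 near the support and then
made periodic, expands in these characters, and applying `f` gives `f̂(ξ) = ∑ B(ξ,n) f̂(λ_n)`
(`GevreyDual.exists_fourier_expansion`), where `|B(ξ,n)| ≤ C_h exp(-h|ξ-λ_n|^{1/s})` for every `h`.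

Let `ξ ∈ Γ₀`. If `λ_n ∈ Γ`, moderateness replaces `ω(ξ)` by `ω(λ_n)` at the cost of a factor
`exp(k|ξ-λ_n|^{1/s})`, which the coefficient absorbs. What remains is the discrete sequence
convolved with an integrable kernel, and Young's inequality applies
(`eLpNorm_lt_top_of_le_lattice_sum`). If `λ_n ∉ Γ`, then `|ξ-λ_n|` dominates both `|ξ|` and `|λ_n|`
(`exists_cone_separation`), so the coefficient beats the growth of `ω` and of `f̂` and the
contribution is at most a constant times `exp(-|ξ|^{1/s})`. Both cases are combined in
`contSeminorm_lt_top_of_expansion`.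

Every rate `h` is needed because the growth rate of `ω` is arbitrary. It is obtained from windows of
Gevrey order `s'` with `1 < s' < s`, whose coefficients contain an infinite product of `sinc`s
(`exists_fourier_window`). The identity of functions near the support passes to `f` because `f` may
be applied termwise (`GevreyDual.hasSum_expSeries`) and annihilates functions vanishing near its
support (`GevreyDual.apply_eq_zero`); the bump functions for the latter are built from the same
windows. -/

open Filter Topology MeasureTheory

/-! ### One-variable Fourier windows with Gevrey decay. -/

section fourier

open FourierTransform

/-- The character `x ↦ exp(-ix)` of the real line. -/
noncomputable def expNegI (x : ℝ) : ℂ := Complex.exp (-Complex.I * (x : ℂ))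

theorem expNegI_add (x y : ℝ) : expNegI (x + y) = expNegI x * expNegI y := by
  simp [expNegI, mul_add, Complex.exp_add]

@[simp] theorem expNegI_zero : expNegI 0 = 1 := by simp [expNegI]

@[simp] theorem norm_expNegI (x : ℝ) : ‖expNegI x‖ = 1 := by
  simp [expNegI, Complex.norm_exp]

theorem continuous_expNegI : Continuous expNegI := by
  unfold expNegI; fun_prop

theorem contDiff_expNegI : ContDiff ℝ (⊤ : ℕ∞) expNegI :=
  (contDiff_const.mul Complex.ofRealCLM.contDiff).cexp

theorem expNegI_sum {ι : Type*} (S : Finset ι) (u : ι → ℝ) :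
    expNegI (∑ i ∈ S, u i) = ∏ i ∈ S, expNegI (u i) := by
  classical
  induction S using Finset.induction_on with
  | empty => simp
  | insert i S hi ih => rw [Finset.sum_insert hi, Finset.prod_insert hi, expNegI_add, ih]

theorem HasSum.of_eq {ι α : Type*} [AddCommMonoid α] [TopologicalSpace α] {f g : ι → α} {a b : α}
    (h : HasSum f a) (hf : ∀ i, g i = f i) (hb : b = a) : HasSum g b := by
  rw [funext hf, hb]; exact h

theorem integral_expNegI_mul (a u : ℝ) :
    ∫ y in -a..a, expNegI (u * y) = 2 * a * Real.sinc (a * u) := by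
  rcases eq_or_ne u 0 with rfl | hu
  · simp; ring
  · have h := intervalIntegral.integral_comp_mul_left
      (f := fun t : ℝ => Complex.exp (t * Complex.I)) (a := -a) (b := a) (c := -u) (by simpa using hu)
    have h1 : (fun y : ℝ => expNegI (u * y)) =
        fun x : ℝ => Complex.exp (((-u * x : ℝ) : ℂ) * Complex.I) := by
      funext y; simp only [expNegI]; congr 1; push_cast; ring
    rw [h1, h]
    have h2 := integral_exp_mul_I_eq_sinc (-u * a)
    have h3 : -u * -a = -(-u * a) := by ring
    rw [h3, h2]
    have h4 : a * u = -(-u * a) := by ring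
    rw [h4, Real.sinc_neg]
    have : (u : ℂ) ≠ 0 := by exact_mod_cast hu
    simp only [Complex.real_smul]
    push_cast
    field_simp

/-- Poisson summation for a modulated function, at a point where only one translate is present. -/
theorem hasSum_fourier_window {T : ℝ → ℂ} (hT : HasCompactSupport T)
    (hT' : ContDiff ℝ (⊤ : ℕ∞) T) (τ t : ℝ) (h0 : ∀ m : ℤ, m ≠ 0 → T (t + m) = 0) :
    HasSum (fun n : ℤ => 𝓕 T (-(n - τ)) * expNegI (2 * Real.pi * (n * t)))
      (T t * expNegI (2 * Real.pi * (τ * t))) := by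
  set g : ℝ → ℂ := fun x => T x * expNegI (2 * Real.pi * (τ * x)) with hg
  have hgs : ContDiff ℝ (⊤ : ℕ∞) g :=
    hT'.mul (contDiff_expNegI.comp (contDiff_const.mul (contDiff_const.mul contDiff_id)))
  have hgc : HasCompactSupport g := hT.mul_right
  set F := hgc.toSchwartzMap hgs
  have hFg : ∀ x, F x = g x := fun x => rfl
  have hgF : ∀ m : ℝ, 𝓕 F m = 𝓕 T (m + τ) := by
    intro m
    have h : (𝓕 F) m = 𝓕 (F : ℝ → ℂ) m := by rw [SchwartzMap.fourier_coe]
    rw [h, Real.fourier_real_eq_integral_exp_smul, Real.fourier_real_eq_integral_exp_smul]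
    congr 1 with v
    rw [hFg, hg]
    simp only [smul_eq_mul, expNegI]
    rw [mul_left_comm, ← Complex.exp_add, mul_comm]
    congr 2
    push_cast; ring
  have hs : Summable fun n : ℤ => 𝓕 F n :=
    summable_of_isBigO (Real.summable_abs_int_rpow one_lt_two)
      (((𝓕 F).isBigO_cocompact_rpow (-2)).comp_tendsto Int.tendsto_coe_cofinite)
  have hs' : Summable fun n : ℤ => 𝓕 F n * fourier n (t : UnitAddCircle) := by
    refine Summable.of_norm ?_
    simpa only [norm_mul, fourier_apply, Circle.norm_coe, mul_one] using hs.norm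
  have hP := SchwartzMap.tsum_eq_tsum_fourier F t
  rw [tsum_eq_single 0 (fun m hm => by rw [hFg, hg]; simp [h0 m hm])] at hP
  have hH := hs'.hasSum
  -- `fourier n` is `e^{2πint}`, opposite in sign to `expNegI`; hence the reindexing by `n ↦ -n`.
  rw [← hP, ← (Equiv.neg ℤ).hasSum_iff] at hH
  simp only [Int.cast_zero, add_zero, hFg, hg] at hH
  refine hH.congr_fun ?_
  intro n
  simp only [Function.comp_apply, Equiv.neg_apply, hgF]
  rw [fourier_coe_apply]
  have e1 : ((-n : ℤ) : ℝ) + τ = -(n - τ) := by push_cast; ring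
  rw [e1]
  congr 1
  simp only [expNegI]
  congr 1
  push_cast
  simp
  ring

/-- Averaging an expansion over a symmetric interval multiplies the coefficients by a `sinc`. -/
theorem hasSum_average {b : ℝ → ℂ} {τ a t : ℝ} {κ : ℂ} (ha : 0 < a)
    (hb : Summable fun n : ℤ => ‖b (n - τ)‖)
    (h : ∀ y, |y - t| ≤ a → HasSum (fun n : ℤ => b (n - τ) * expNegI (2 * Real.pi * (n * y)))
      (κ * expNegI (2 * Real.pi * (τ * y)))) :
    HasSum (fun n : ℤ => b (n - τ) * (Real.sinc (a * (2 * Real.pi * (n - τ))) : ℂ) *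
      expNegI (2 * Real.pi * (n * t))) (κ * expNegI (2 * Real.pi * (τ * t))) := by
  -- The expansion at `t + y` is multiplied by `e^{2πiτy}`, which makes its sum independent of `y`.
  -- Integration over `[-a, a]` then only affects the coefficients.
  have key : HasSum (fun n : ℤ => ∫ y in -a..a, b (n - τ) * expNegI (2 * Real.pi * (n * t)) *
      expNegI (2 * Real.pi * (n - τ) * y)) (∫ y in -a..a, κ * expNegI (2 * Real.pi * (τ * t))) := by
    refine intervalIntegral.hasSum_integral_of_dominated_convergence
      (fun n _ => ‖b (n - τ)‖) ?_ ?_ ?_ ?_ ?_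
    · intro n
      refine Continuous.aestronglyMeasurable ?_
      exact continuous_const.mul (continuous_expNegI.comp (continuous_const.mul continuous_id))
    · intro n; refine .of_forall fun y _ => ?_
      simp
    · exact .of_forall fun y _ => hb
    · simp
    · refine .of_forall fun y hy => ?_
      rw [Set.uIoc_of_le (by linarith)] at hy
      have h1 := (h (t + y) (by rw [add_sub_cancel_left, abs_le]; exact ⟨hy.1.le, hy.2⟩)).mul_right
        (expNegI (-(2 * Real.pi * (τ * y))))
      refine h1.of_eq (fun n => ?_) ?_
      · rw [mul_assoc (b _), mul_assoc (b _), ← expNegI_add, ← expNegI_add]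
        congr 2; ring
      · rw [mul_assoc κ, ← expNegI_add]
        congr 2; ring
  have h2 := key.mul_right (2 * a : ℂ)⁻¹
  have ha' : (a : ℂ) ≠ 0 := by exact_mod_cast ha.ne'
  refine h2.of_eq (fun n => ?_) ?_
  · rw [intervalIntegral.integral_const_mul, integral_expNegI_mul]
    field_simp
  · rw [intervalIntegral.integral_const]
    simp only [sub_neg_eq_add, Complex.real_smul]
    push_cast
    field_simp
    ring

theorem abs_sinc_sub_one_le (u : ℝ) : |Real.sinc u - 1| ≤ 2 * |u| := by
  wlog hu : 0 ≤ u generalizing u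
  · have h := this (-u) (by linarith)
    rwa [Real.sinc_neg, abs_neg] at h
  rw [abs_of_nonneg hu]
  rcases le_or_gt 1 u with h1 | h1
  · have := abs_le.1 (Real.abs_sinc_le_one u)
    rw [abs_le]; constructor <;> linarith
  · rcases hu.eq_or_lt with rfl | hu
    · simp
    · have h2 := Real.sin_gt_sub_cube hu
      have h3 : u * Real.sinc u = Real.sin u := by
        rw [Real.sinc_of_ne_zero hu.ne']; field_simp
      rw [abs_le]
      constructor
      · have : u * (1 - 2 * u) ≤ u * Real.sinc u := by rw [h3]; nlinarith [mul_pos hu hu]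
        have := le_of_mul_le_mul_left this hu
        linarith
      · linarith [Real.sinc_le_one u]

theorem abs_sinc_mul_abs_le (u : ℝ) : |Real.sinc u| * |u| ≤ 1 := by
  rcases eq_or_ne u 0 with rfl | hu
  · simp
  · rw [Real.sinc_of_ne_zero hu, ← abs_mul, div_mul_cancel₀ _ hu]
    exact Real.abs_sin_le_one u

/-- Iterated averaging over intervals of summable lengths: the coefficients are multiplied by
an infinite product of `sinc`s. -/
theorem hasSum_tprod_sinc {b : ℝ → ℂ} {a : ℕ → ℝ} {A : ℝ} {τ t : ℝ} {κ : ℂ} (ha : ∀ k, 0 < a k)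
    (hA : HasSum a A) (hb : Summable fun n : ℤ => ‖b (n - τ)‖)
    (h : ∀ y, |y - t| ≤ A → HasSum (fun n : ℤ => b (n - τ) * expNegI (2 * Real.pi * (n * y)))
      (κ * expNegI (2 * Real.pi * (τ * y)))) :
    HasSum (fun n : ℤ => b (n - τ) *
      ((∏' k, Real.sinc (a k * (2 * Real.pi * (n - τ))) : ℝ) : ℂ) *
      expNegI (2 * Real.pi * (n * t))) (κ * expNegI (2 * Real.pi * (τ * t))) := by
  have hle : ∀ (N : ℕ) (x : ℝ), |∏ k ∈ Finset.range N, Real.sinc (a k * x)| ≤ 1 := fun N x => by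
    rw [Finset.abs_prod]
    exact Finset.prod_le_one (fun _ _ => abs_nonneg _) fun _ _ => Real.abs_sinc_le_one _
  have hbound : ∀ (N : ℕ) (n : ℤ), ‖b (n - τ) *
      ((∏ k ∈ Finset.range N, Real.sinc (a k * (2 * Real.pi * (n - τ))) : ℝ) : ℂ)‖ ≤
      ‖b (n - τ)‖ := fun N n => by
    rw [norm_mul, Complex.norm_real, Real.norm_eq_abs]
    exact mul_le_of_le_one_right (norm_nonneg _) (hle _ _)
  -- Each averaging uses up `a N` of the radius on which the expansion is known; the total `A`
  -- leaves at least the centre `t`.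
  have hfin : ∀ N : ℕ, ∀ y, |y - t| ≤ A - ∑ k ∈ Finset.range N, a k →
      HasSum (fun n : ℤ => b (n - τ) *
      ((∏ k ∈ Finset.range N, Real.sinc (a k * (2 * Real.pi * (n - τ))) : ℝ) : ℂ) *
      expNegI (2 * Real.pi * (n * y))) (κ * expNegI (2 * Real.pi * (τ * y))) := by
    intro N
    induction N with
    | zero => intro y hy; simpa using h y (by simpa using hy)
    | succ N ih =>
      intro y hy
      rw [Finset.sum_range_succ] at hy
      have := hasSum_average (b := fun x => b x *
        ((∏ k ∈ Finset.range N, Real.sinc (a k * (2 * Real.pi * x)) : ℝ) : ℂ)) (τ := τ) (t := y)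
        (κ := κ) (ha N) (Summable.of_nonneg_of_le (fun _ => norm_nonneg _) (hbound N) hb)
        (fun z hz => ih z (by
          have := abs_sub_le z y t
          linarith))
      refine this.of_eq (fun n => ?_) rfl
      rw [Finset.prod_range_succ]
      push_cast
      ring
  have hs : ∀ N : ℕ, HasSum (fun n : ℤ => b (n - τ) *
      ((∏ k ∈ Finset.range N, Real.sinc (a k * (2 * Real.pi * (n - τ))) : ℝ) : ℂ) *
      expNegI (2 * Real.pi * (n * t))) (κ * expNegI (2 * Real.pi * (τ * t))) := fun N =>
    hfin N t (by
      rw [sub_self, abs_zero, sub_nonneg]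
      exact sum_le_hasSum _ (fun k _ => (ha k).le) hA)
  have hlim : ∀ x : ℝ, Tendsto (fun N => ∏ k ∈ Finset.range N, Real.sinc (a k * x)) atTop
      (𝓝 (∏' k, Real.sinc (a k * x))) := fun x => by
    have hm : Multipliable fun k => 1 + (Real.sinc (a k * x) - 1) := by
      refine multipliable_one_add_of_summable ?_
      refine Summable.of_nonneg_of_le (fun _ => norm_nonneg _)
        (fun k => abs_sinc_sub_one_le _) ?_
      simp only [abs_mul]
      simp only [abs_of_pos (ha _)]
      exact (hA.summable.mul_right _).mul_left _
    simp only [add_sub_cancel] at hm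
    exact hm.hasProd.tendsto_prod_nat
  have hsum : Summable (fun n : ℤ => b (n - τ) *
      ((∏' k, Real.sinc (a k * (2 * Real.pi * (n - τ))) : ℝ) : ℂ) *
      expNegI (2 * Real.pi * (n * t))) := by
    refine Summable.of_norm (Summable.of_nonneg_of_le (fun _ => norm_nonneg _) (fun n => ?_) hb)
    rw [norm_mul, norm_expNegI, mul_one, norm_mul, Complex.norm_real, Real.norm_eq_abs]
    refine mul_le_of_le_one_right (norm_nonneg _) ?_
    exact le_of_tendsto' (hlim _).abs fun N => hle N _
  have hT := tendsto_tsum_of_dominated_convergence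
    (f := fun N (n : ℤ) => b (n - τ) *
      ((∏ k ∈ Finset.range N, Real.sinc (a k * (2 * Real.pi * (n - τ))) : ℝ) : ℂ) *
      expNegI (2 * Real.pi * (n * t)))
    (g := fun n : ℤ => b (n - τ) *
      ((∏' k, Real.sinc (a k * (2 * Real.pi * (n - τ))) : ℝ) : ℂ) *
      expNegI (2 * Real.pi * (n * t))) hb
    (fun n => ((Complex.continuous_ofReal.tendsto _).comp (hlim _)).const_mul _ |>.mul_const _)
    (Eventually.of_forall (f := atTop) fun N n => by
      rw [norm_mul, norm_expNegI, mul_one]; exact hbound N n)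
  simp only [fun N => (hs N).tsum_eq] at hT
  have := tendsto_nhds_unique hT tendsto_const_nhds
  rw [← this]
  exact hsum.hasSum

/-- Each of the first `N` factors, multiplied by `|x|`, is at most `1 / a k` in modulus, and all
later factors are at most 1. The lengths `a k` thus determine the Gevrey order of the window. -/
theorem abs_tprod_sinc_mul_pow_le {a : ℕ → ℝ} (ha : ∀ k, 0 < a k) (hA : Summable a) (x : ℝ)
    (N : ℕ) : |∏' k, Real.sinc (a k * x)| * |x| ^ N ≤ ∏ k ∈ Finset.range N, (a k)⁻¹ := by
  have hm : Multipliable fun k => 1 + (Real.sinc (a k * x) - 1) := by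
    refine multipliable_one_add_of_summable ?_
    refine Summable.of_nonneg_of_le (fun _ => norm_nonneg _)
      (fun k => abs_sinc_sub_one_le _) ?_
    simp only [abs_mul]
    simp only [abs_of_pos (ha _)]
    exact (hA.mul_right _).mul_left _
  simp only [add_sub_cancel] at hm
  have hlim := hm.hasProd.tendsto_prod_nat.abs.mul_const (|x| ^ N)
  refine le_of_tendsto hlim (eventually_atTop.2 ⟨N, fun M hM => ?_⟩)
  rw [Finset.abs_prod]
  have h1 : ∏ k ∈ Finset.range M, |Real.sinc (a k * x)| ≤
      ∏ k ∈ Finset.range N, |Real.sinc (a k * x)| :=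
by
    rw [← Finset.prod_range_mul_prod_Ico _ hM]
    exact mul_le_of_le_one_right (Finset.prod_nonneg fun _ _ => abs_nonneg _)
      (Finset.prod_le_one (fun _ _ => abs_nonneg _) fun _ _ => Real.abs_sinc_le_one _)
  calc _ ≤ (∏ k ∈ Finset.range N, |Real.sinc (a k * x)|) * |x| ^ N := by gcongr
    _ = ∏ k ∈ Finset.range N, (|Real.sinc (a k * x)| * |x|) := by
      rw [Finset.prod_mul_distrib]; simp
    _ ≤ _ := by
      refine Finset.prod_le_prod (fun _ _ => by positivity) fun k _ => ?_
      have := abs_sinc_mul_abs_le (a k * x)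
      rw [abs_mul, abs_of_pos (ha k), mul_left_comm] at this
      rw [← one_div, le_div_iff₀ (ha k)]
      linarith

/-- Power bounds of Gevrey type give decay faster than `exp(-h |x|^{1/s})` for every `h`. -/
theorem exists_decay_of_pow_bound {s s' : ℝ} (hs : 1 < s) (hs' : s' < s) {b : ℝ → ℂ} {C B : ℝ}
    (hC : 0 ≤ C) (hB : 0 ≤ B)
    (h : ∀ (x : ℝ) (N : ℕ), ‖b x‖ * |x| ^ N ≤ C * B ^ N * (N.factorial : ℝ) ^ s') (h' : ℝ) :
    ∃ C' : ℝ, ∀ x, ‖b x‖ ≤ C' * Real.exp (-h' * |x| ^ (1 / s)) := by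
  have hs0 : 0 < s := by linarith
  set κ : ℝ := 1 - s' / s with hκ
  have hκ0 : 0 < κ := by rw [hκ, sub_pos, div_lt_one hs0]; exact hs'
  -- The factor 2 makes the exponential series for the rate `|h'|` converge like a geometric series
  -- of ratio 1/2.
  set H : ℝ := 2 * |h'| with hH
  set X : ℝ := H * B ^ (1 / s) with hX
  have hX0 : 0 ≤ X := by positivity
  set M : ℝ := Real.exp (κ * X ^ (1 / κ)) with hM
  -- As `κ > 0`, the power `N!^κ` outgrows every geometric sequence; the gap between `s'` and `s` is
  -- what makes every rate attainable.
  have hfac : ∀ N : ℕ, X ^ N ≤ M * (N.factorial : ℝ) ^ κ := by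
    intro N
    have h1 : (X ^ (1 / κ)) ^ N / N.factorial ≤ Real.exp (X ^ (1 / κ)) :=
      Real.pow_div_factorial_le_exp _ (by positivity) N
    have hf : (0 : ℝ) < N.factorial := by exact_mod_cast N.factorial_pos
    rw [div_le_iff₀ hf] at h1
    have h2 := Real.rpow_le_rpow (by positivity) h1 hκ0.le
    rw [Real.mul_rpow (Real.exp_pos _).le hf.le, ← Real.exp_mul] at h2
    have h3 : ((X ^ (1 / κ)) ^ N) ^ κ = X ^ N := by
      rw [← Real.rpow_natCast, ← Real.rpow_mul hX0, ← Real.rpow_mul hX0, ← Real.rpow_natCast]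
      congr 1; field_simp
    rw [h3] at h2
    rw [hM, mul_comm κ]
    exact h2
  have hb0 : ∀ x, ‖b x‖ ≤ C := fun x => by simpa using h x 0
  set D : ℝ := C ^ (1 / s) * C ^ (1 - 1 / s) * M with hD
  have hDn : 0 ≤ D := by positivity
  have hs1 : 0 ≤ 1 - 1 / s := by
    rw [sub_nonneg, div_le_one hs0]; exact hs.le
  -- The hypothesis is raised to the power `1 / s`; the remaining factor `‖b x‖ ^ (1 - 1 / s)` is
  -- bounded by the case `N = 0`.
  have hterm : ∀ (x : ℝ) (N : ℕ), ‖b x‖ * (H * |x| ^ (1 / s)) ^ N ≤ D * N.factorial := by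
    intro x N
    have hf : (0 : ℝ) < N.factorial := by exact_mod_cast N.factorial_pos
    have e1 : ‖b x‖ = ‖b x‖ ^ (1 / s) * ‖b x‖ ^ (1 - 1 / s) := by
      rcases (norm_nonneg (b x)).eq_or_lt with h0 | h0
      · rw [← h0, Real.zero_rpow (by positivity), zero_mul]
      · rw [← Real.rpow_add h0]; simp
    have e2 : (|x| ^ (1 / s)) ^ N = (|x| ^ N) ^ (1 / s) := by
      rw [← Real.rpow_natCast, ← Real.rpow_mul (abs_nonneg _), mul_comm, Real.rpow_mul (abs_nonneg _),
        Real.rpow_natCast]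
    have e3 : (C * B ^ N * (N.factorial : ℝ) ^ s') ^ (1 / s) =
        C ^ (1 / s) * (B ^ (1 / s)) ^ N * (N.factorial : ℝ) ^ (s' / s) := by
      rw [Real.mul_rpow (by positivity) (by positivity), Real.mul_rpow hC (by positivity),
        ← Real.rpow_mul hf.le, ← Real.rpow_natCast, ← Real.rpow_natCast, ← Real.rpow_mul hB,
        ← Real.rpow_mul hB, mul_comm (N : ℝ)]
      congr 2; ring
    have e4 : (N.factorial : ℝ) ^ κ * (N.factorial : ℝ) ^ (s' / s) = N.factorial := by
      rw [← Real.rpow_add hf, hκ]; simp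
    calc ‖b x‖ * (H * |x| ^ (1 / s)) ^ N
        = H ^ N * (‖b x‖ * |x| ^ N) ^ (1 / s) * ‖b x‖ ^ (1 - 1 / s) := by
          rw [Real.mul_rpow (norm_nonneg _) (by positivity), mul_pow, e2]
          conv_lhs => rw [e1]
          ring
      _ ≤ H ^ N * (C * B ^ N * (N.factorial : ℝ) ^ s') ^ (1 / s) * C ^ (1 - 1 / s) := by
          have h1 := Real.rpow_le_rpow (by positivity) (h x N) (by positivity : 0 ≤ 1 / s)
          have h2 := Real.rpow_le_rpow (by positivity) (hb0 x) hs1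
          gcongr
      _ = C ^ (1 / s) * C ^ (1 - 1 / s) * X ^ N * (N.factorial : ℝ) ^ (s' / s) := by
          rw [e3, hX, mul_pow]; ring
      _ ≤ C ^ (1 / s) * C ^ (1 - 1 / s) * (M * (N.factorial : ℝ) ^ κ) *
          (N.factorial : ℝ) ^ (s' / s) := by gcongr; exact hfac N
      _ = D * ((N.factorial : ℝ) ^ κ * (N.factorial : ℝ) ^ (s' / s)) := by rw [hD]; ring
      _ = D * N.factorial := by rw [e4]
  refine ⟨D * 2, fun x => ?_⟩
  set y : ℝ := |x| ^ (1 / s) with hy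
  have hy0 : 0 ≤ y := by positivity
  have h5 : ‖b x‖ * Real.exp (|h'| * y) ≤ D * 2 := by
    have hs2 : HasSum (fun N : ℕ => ‖b x‖ * ((|h'| * y) ^ N / N.factorial))
        (‖b x‖ * Real.exp (|h'| * y)) := by
      refine HasSum.mul_left _ ?_
      rw [Real.exp_eq_exp_ℝ]
      exact NormedSpace.expSeries_div_hasSum_exp _
    have hs3 : HasSum (fun N : ℕ => D * (1 / 2 : ℝ) ^ N) (D * 2) := hasSum_geometric_two.mul_left _
    refine hasSum_le (fun N => ?_) hs2 hs3
    have hf : (0 : ℝ) < N.factorial := by exact_mod_cast N.factorial_pos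
    have h6 := hterm x N
    have : (H * |x| ^ (1 / s)) ^ N = 2 ^ N * (|h'| * y) ^ N := by
      rw [hH, ← mul_pow]; congr 1; ring
    rw [this] at h6
    rw [one_div, inv_pow, ← div_eq_mul_inv, le_div_iff₀ (by positivity), ← mul_div_assoc,
      div_mul_eq_mul_div, div_le_iff₀ hf]
    linarith
  have h7 : Real.exp (h' * y) ≤ Real.exp (|h'| * y) := by
    gcongr; exact le_abs_self h'
  rw [neg_mul, Real.exp_neg, ← div_eq_mul_inv, le_div_iff₀ (Real.exp_pos _)]
  exact (mul_le_mul_of_nonneg_left h7 (norm_nonneg _)).trans h5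

/-- A coefficient function, of rapid decay in the sense of `exp(-h |·|^{1/s})` for every `h`, whose
modulated Fourier series is the modulating character on a given window and vanishes away from a
slightly larger window. -/
theorem exists_fourier_window {s : ℝ} (hs : 1 < s) {r R : ℝ} (hr : 0 < r) (hrR : r < R)
    (hR : R < 1 / 2) :
    ∃ b : ℝ → ℂ, (∀ h : ℝ, ∃ C : ℝ, ∀ x, ‖b x‖ ≤ C * Real.exp (-h * |x| ^ (1 / s))) ∧
      (∀ τ t : ℝ, |t - 1 / 2| ≤ r →
        HasSum (fun n : ℤ => b (n - τ) * expNegI (2 * Real.pi * (n * t)))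
          (expNegI (2 * Real.pi * (τ * t)))) ∧
      (∀ τ t : ℝ, R ≤ |t - 1 / 2| → |t - 1 / 2| ≤ 1 / 2 →
        HasSum (fun n : ℤ => b (n - τ) * expNegI (2 * Real.pi * (n * t))) 0) := by
  -- The bump is 1 up to radius `r + A` and 0 beyond `r + 2A`. Averaging of total radius `A` shifts
  -- these bounds to `r` and `r + 3A = R`.
  set A : ℝ := (R - r) / 3 with hA
  have hA0 : 0 < A := by rw [hA]; linarith
  set β : ContDiffBump (1 / 2 : ℝ) :=
    { rIn := r + A, rOut := r + 2 * A, rIn_pos := by linarith, rIn_lt_rOut := by linarith } with hβ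
  set T : ℝ → ℂ := fun x => ((β x : ℝ) : ℂ) with hT
  have hTc : HasCompactSupport T := β.hasCompactSupport.comp_left (g := fun x : ℝ => (x : ℂ)) (by simp)
  have hTs : ContDiff ℝ (⊤ : ℕ∞) T := Complex.ofRealCLM.contDiff.comp β.contDiff
  have hT0 : ∀ x, r + 2 * A ≤ |x - 1 / 2| → T x = 0 := fun x hx => by
    rw [hT]; simp only
    rw [β.zero_of_le_dist (by rw [Real.dist_eq]; exact hx)]; simp
  have hT1 : ∀ x, |x - 1 / 2| ≤ r + A → T x = 1 := fun x hx => by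
    rw [hT]; simp only
    rw [β.one_of_mem_closedBall (by rw [Metric.mem_closedBall, Real.dist_eq]; exact hx)]; simp
  -- The margin `A` is needed because the averages reach outside the unit cell; `R < 1/2` keeps the
  -- other translates away even there.
  have htrans : ∀ x, |x - 1 / 2| ≤ 1 / 2 + A → ∀ m : ℤ, m ≠ 0 → T (x + m) = 0 := by
    intro x hx m hm
    refine hT0 _ ?_
    have h1 : (1 : ℝ) ≤ |(m : ℝ)| := by exact_mod_cast Int.one_le_abs hm
    have h2 : |(m : ℝ)| ≤ |x + m - 1 / 2| + |x - 1 / 2| := by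
      have := abs_sub (x + m - 1 / 2) (x - 1 / 2)
      have e : x + m - 1 / 2 - (x - 1 / 2) = m := by ring
      rwa [e] at this
    linarith
  -- Lengths proportional to `(k + 1)^{-s'}` are summable since `s' > 1`, and the product of their
  -- inverses grows like `N!^{s'}` up to a geometric factor, with `s' < s`.
  obtain ⟨s', hs1, hs2⟩ := exists_between hs
  have hsum : Summable fun k : ℕ => 1 / ((k : ℝ) + 1) ^ s' := by
    have := (summable_nat_add_iff 1).2 (Real.summable_one_div_nat_rpow.2 hs1)
    simpa using this
  set Z : ℝ := ∑' k : ℕ, 1 / ((k : ℝ) + 1) ^ s' with hZ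
  have hZ0 : 0 < Z := hsum.tsum_pos (fun k => by positivity) 0 (by positivity)
  set a : ℕ → ℝ := fun k => A / Z * (1 / ((k : ℝ) + 1) ^ s') with ha
  have ha0 : ∀ k, 0 < a k := fun k => by positivity
  have haA : HasSum a A := by
    have := hsum.hasSum.mul_left (A / Z)
    rwa [div_mul_cancel₀ _ hZ0.ne'] at this
  set b₀ : ℝ → ℂ := fun x => 𝓕 T (-x) with hb₀
  set F := hTc.toSchwartzMap hTs
  have hFT : ∀ x, 𝓕 F x = 𝓕 T x := fun x => by rw [SchwartzMap.fourier_coe]; rfl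
  have hb₀s : ∀ τ : ℝ, Summable fun n : ℤ => ‖b₀ (n - τ)‖ := by
    intro τ
    obtain ⟨C, hC⟩ := (𝓕 F).decay 2 0
    have hbd2 : ∀ x : ℝ, |x| ^ 2 * ‖𝓕 T x‖ ≤ C := fun x => by
      have := hC.2 x; simpa [← hFT] using this
    have h1 : Summable fun n : ℤ => 1 / |(n : ℝ) + -τ| ^ (2 : ℝ) :=
      (Real.summable_one_div_int_add_rpow (-τ) 2).2 one_lt_two
    have h2 : Summable fun n : ℤ => C * (1 / |(n : ℝ) + -τ| ^ (2 : ℝ)) := h1.mul_left C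
    refine Summable.of_norm_bounded_eventually h2 ?_
    have h3 : {n : ℤ | (n : ℝ) = τ}.Finite :=
      Set.Subsingleton.finite fun x hx y hy => by
        have : (x : ℝ) = y := hx.trans hy.symm
        exact_mod_cast this
    filter_upwards [h3.compl_mem_cofinite] with n hn
    have hn' : (n : ℝ) - τ ≠ 0 := sub_ne_zero.2 hn
    have h4 := hbd2 (-(n - τ))
    rw [abs_neg] at h4
    simp only [hb₀, norm_norm]
    rw [← sub_eq_add_neg, Real.rpow_two, mul_one_div, le_div_iff₀ (by positivity)]
    linarith
  refine ⟨fun x => b₀ x * ((∏' k, Real.sinc (a k * (2 * Real.pi * x)) : ℝ) : ℂ), ?_, ?_, ?_⟩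
  · intro h
    obtain ⟨C0, hC0⟩ := (𝓕 F).decay 0 0
    have hbd : ∀ x : ℝ, ‖b₀ x‖ ≤ C0 := fun x => by
      have := hC0.2 (-x); simpa [hb₀, ← hFT] using this
    refine exists_decay_of_pow_bound hs hs2 (C := C0) (B := Z / A) hC0.1.le (by positivity) ?_ h
    intro x N
    rw [norm_mul, Complex.norm_real, Real.norm_eq_abs]
    have h1 := abs_tprod_sinc_mul_pow_le ha0 haA.summable (2 * Real.pi * x) N
    have h2 : |x| ≤ |2 * Real.pi * x| := by
      rw [abs_mul, abs_of_pos Real.two_pi_pos]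
      nlinarith [abs_nonneg x, Real.pi_gt_three]
    have h3 : ∏ k ∈ Finset.range N, (a k)⁻¹ = (Z / A) ^ N * (N.factorial : ℝ) ^ s' := by
      simp only [ha, mul_inv, inv_div, one_div, inv_inv]
      rw [Finset.prod_mul_distrib, Finset.prod_const, Finset.card_range,
        Real.finsetProd_rpow _ _ (fun i _ => by positivity)]
      congr 2
      rw [← Finset.prod_range_add_one_eq_factorial]
      push_cast; rfl
    calc _ ≤ C0 * |∏' k, Real.sinc (a k * (2 * Real.pi * x))| * |2 * Real.pi * x| ^ N := by
          have := hbd x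
          have hC := hC0.1.le
          gcongr
      _ ≤ C0 * ((Z / A) ^ N * (N.factorial : ℝ) ^ s') := by
          rw [mul_assoc]
          exact mul_le_mul_of_nonneg_left (h1.trans_eq h3) hC0.1.le
      _ = _ := by ring
  · intro τ t ht
    have := hasSum_tprod_sinc (κ := 1) (t := t) ha0 haA (hb₀s τ) (fun y hy => by
      have h1 := abs_sub_le y t (1 / 2)
      have h2 := hasSum_fourier_window hTc hTs τ y (htrans y (by linarith))
      rw [hT1 y (by linarith)] at h2
      exact h2)
    rwa [one_mul] at this
  · intro τ t ht ht'
    have := hasSum_tprod_sinc (κ := 0) (t := t) ha0 haA (hb₀s τ) (fun y hy => by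
      have h1 := abs_sub_le y t (1 / 2)
      have h1' := abs_sub_le t y (1 / 2)
      rw [abs_sub_comm t y] at h1'
      have h2 := hasSum_fourier_window hTc hTs τ y (htrans y (by linarith))
      rw [hT0 y (by linarith)] at h2
      exact h2)
    rwa [zero_mul] at this

end fourier

/-! ### Locality of the Gevrey class and its stability under products. -/

section gevrey

variable {d : ℕ}

theorem Filter.EventuallyEq.partialDeriv {φ ψ : EuclideanSpace ℝ (Fin d) → ℂ}
    {x : EuclideanSpace ℝ (Fin d)} (h : φ =ᶠ[𝓝 x] ψ) (i : Fin d) :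
    _root_.partialDeriv i φ =ᶠ[𝓝 x] _root_.partialDeriv i ψ :=
  (h.fderiv (𝕜 := ℝ)).mono fun y hy => by simp only [_root_.partialDeriv, hy]

theorem Filter.EventuallyEq.multiDeriv {φ ψ : EuclideanSpace ℝ (Fin d) → ℂ}
    {x : EuclideanSpace ℝ (Fin d)} (h : φ =ᶠ[𝓝 x] ψ) (β : Fin d → ℕ) :
    _root_.multiDeriv β φ =ᶠ[𝓝 x] _root_.multiDeriv β ψ := by
  rw [_root_.multiDeriv, _root_.multiDeriv]
  induction List.finRange d with
  | nil => exact h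
  | cons i l ih =>
    change (_root_.partialDeriv i)^[β i] _ =ᶠ[𝓝 x] (_root_.partialDeriv i)^[β i] _
    induction β i with
    | zero => exact ih
    | succ n ih' =>
      rw [Function.iterate_succ_apply', Function.iterate_succ_apply']
      exact ih'.partialDeriv i

theorem multiDeriv_zero (β : Fin d → ℕ) :
    multiDeriv β (0 : EuclideanSpace ℝ (Fin d) → ℂ) = 0 := by
  have h := listDeriv_smul β (List.finRange d) 0 (φ := (0 : EuclideanSpace ℝ (Fin d) → ℂ))
    contDiff_const
  rwa [zero_smul, zero_smul] at h

/-- A function which near every point agrees with `φ` or with `0` is in the Gevrey space if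
`φ` is. -/
theorem mem_gevreySpace_of_eventuallyEq {s : ℝ} {φ ψ : EuclideanSpace ℝ (Fin d) → ℂ}
    (hφ : φ ∈ gevreySpace d s) (h : ∀ x, ψ =ᶠ[𝓝 x] φ ∨ ψ =ᶠ[𝓝 x] 0) : ψ ∈ gevreySpace d s := by
  refine ⟨contDiff_iff_contDiffAt.2 fun x => ?_, fun K hK => ?_⟩
  · rcases h x with hx | hx
    · exact (hφ.1.contDiffAt).congr_of_eventuallyEq hx
    · exact (contDiffAt_const (c := 0)).congr_of_eventuallyEq hx
  · obtain ⟨A, hA, hn⟩ := hφ.2 K hK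
    refine ⟨A, hA, lt_of_le_of_lt (iSup_le fun β => iSup₂_le fun x hx => ?_) hn⟩
    rcases h x with h' | h'
    · rw [(h'.multiDeriv β).eq_of_nhds]
      exact le_iSup_of_le β (le_iSup₂_of_le x hx le_rfl)
    · rw [(h'.multiDeriv β).eq_of_nhds, multiDeriv_zero]
      simp

theorem gevreyNorm_eq_zero {s A : ℝ} {K : Set (EuclideanSpace ℝ (Fin d))}
    {φ : EuclideanSpace ℝ (Fin d) → ℂ} (h : ∀ x ∈ K, φ =ᶠ[𝓝 x] 0) : gevreyNorm s A K φ = 0 := by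
  refine le_antisymm (iSup_le fun β => iSup₂_le fun x hx => ?_) zero_le
  rw [((h x hx).multiDeriv β).eq_of_nhds, multiDeriv_zero]
  simp

theorem partialDeriv_iterate_sum {ι : Type*} (S : Finset ι) (i : Fin d) (n : ℕ)
    {φ : ι → EuclideanSpace ℝ (Fin d) → ℂ} (h : ∀ j, ContDiff ℝ (⊤ : ℕ∞) (φ j)) :
    (partialDeriv i)^[n] (∑ j ∈ S, φ j) = ∑ j ∈ S, (partialDeriv i)^[n] (φ j) := by
  classical
  induction S using Finset.induction_on with
  | empty =>
    have h := partialDeriv_iterate_smul i n 0 (φ := (0 : EuclideanSpace ℝ (Fin d) → ℂ))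
      contDiff_const
    simpa using h
  | insert j S hj ih =>
    rw [Finset.sum_insert hj, Finset.sum_insert hj, ← ih]
    refine partialDeriv_iterate_add i n (h j) ?_
    have : (∑ j ∈ S, φ j) = fun x => ∑ j ∈ S, φ j x := by funext x; simp
    rw [this]
    exact ContDiff.sum fun j _ => h j

theorem partialDeriv_mul (i : Fin d) {φ ψ : EuclideanSpace ℝ (Fin d) → ℂ}
    (h : ContDiff ℝ (⊤ : ℕ∞) φ) (h' : ContDiff ℝ (⊤ : ℕ∞) ψ) :
    partialDeriv i (φ * ψ) = partialDeriv i φ * ψ + φ * partialDeriv i ψ := by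
  funext x
  simp only [partialDeriv, Pi.add_apply, Pi.mul_apply]
  rw [fderiv_mul (h.differentiable (by simp) x) (h'.differentiable (by simp) x)]
  simp
  ring

/-- The Leibniz rule for an iterated partial derivative, as a sum of `2 ^ n` terms. -/
theorem exists_partialDeriv_iterate_mul (i : Fin d) (n : ℕ) :
    ∃ (ι : Type) (_ : Fintype ι) (p q : ι → ℕ), Fintype.card ι = 2 ^ n ∧ (∀ j, p j + q j = n) ∧
      ∀ φ ψ : EuclideanSpace ℝ (Fin d) → ℂ, ContDiff ℝ (⊤ : ℕ∞) φ → ContDiff ℝ (⊤ : ℕ∞) ψ →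
        (partialDeriv i)^[n] (φ * ψ) =
          ∑ j, (partialDeriv i)^[p j] φ * (partialDeriv i)^[q j] ψ := by
  induction n with
  | zero =>
    exact ⟨Unit, inferInstance, fun _ => 0, fun _ => 0, by simp, by simp, fun φ ψ _ _ => by simp⟩
  | succ n ih =>
    obtain ⟨ι, _, p, q, hc, hpq, hL⟩ := ih
    refine ⟨ι ⊕ ι, inferInstance, Sum.elim (fun j => p j + 1) p, Sum.elim q (fun j => q j + 1),
      by rw [Fintype.card_sum, hc]; ring, ?_, ?_⟩
    · rintro (j | j) <;> simp only [Sum.elim_inl, Sum.elim_inr] <;> have := hpq j <;> omega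
    · intro φ ψ h h'
      have hs : ∀ j, ContDiff ℝ (⊤ : ℕ∞)
          ((partialDeriv i)^[p j] φ * (partialDeriv i)^[q j] ψ) := fun j =>
        (contDiff_partialDeriv_iterate i _ h).mul (contDiff_partialDeriv_iterate i _ h')
      rw [Function.iterate_succ_apply', hL φ ψ h h']
      have h1 := partialDeriv_iterate_sum Finset.univ i 1 hs
      simp only [Function.iterate_one] at h1
      rw [h1, Fintype.sum_sum_type, ← Finset.sum_add_distrib]
      refine Finset.sum_congr rfl fun j _ => ?_
      rw [partialDeriv_mul i (contDiff_partialDeriv_iterate i _ h)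
        (contDiff_partialDeriv_iterate i _ h')]
      simp only [Sum.elim_inl, Sum.elim_inr, Function.iterate_succ_apply']

theorem listDeriv_congr {β γ : Fin d → ℕ} {l : List (Fin d)} (h : ∀ i ∈ l, β i = γ i)
    (φ : EuclideanSpace ℝ (Fin d) → ℂ) : listDeriv β l φ = listDeriv γ l φ := by
  induction l with
  | nil => rfl
  | cons i l ih =>
    change (partialDeriv i)^[β i] (listDeriv β l φ) = (partialDeriv i)^[γ i] (listDeriv γ l φ)
    rw [ih fun j hj => h j (List.mem_cons_of_mem _ hj), h i List.mem_cons_self]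

/-- The Leibniz rule for `listDeriv`, as a sum of `2 ^ |β|` terms. -/
theorem exists_listDeriv_mul (β : Fin d → ℕ) (l : List (Fin d)) (hl : l.Nodup) :
    ∃ (ι : Type) (_ : Fintype ι) (p q : ι → Fin d → ℕ), Fintype.card ι = 2 ^ (l.map β).sum ∧
      (∀ j, ∀ i ∈ l, p j i + q j i = β i) ∧
      ∀ φ ψ : EuclideanSpace ℝ (Fin d) → ℂ, ContDiff ℝ (⊤ : ℕ∞) φ → ContDiff ℝ (⊤ : ℕ∞) ψ →
        listDeriv β l (φ * ψ) = ∑ j, listDeriv (p j) l φ * listDeriv (q j) l ψ := by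
  induction l with
  | nil =>
    exact ⟨Unit, inferInstance, fun _ => 0, fun _ => 0, by simp, by simp,
      fun φ ψ _ _ => by simp [listDeriv]⟩
  | cons i l ih =>
    obtain ⟨hi, hl'⟩ := List.nodup_cons.1 hl
    obtain ⟨ι, _, p, q, hc, hpq, hL⟩ := ih hl'
    obtain ⟨κ, _, u, v, hc', huv, hL'⟩ := exists_partialDeriv_iterate_mul i (β i)
    refine ⟨ι × κ, inferInstance, fun j => Function.update (p j.1) i (u j.2),
      fun j => Function.update (q j.1) i (v j.2), ?_, ?_, ?_⟩
    · rw [Fintype.card_prod, hc, hc', List.map_cons, List.sum_cons, pow_add, mul_comm]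
    · rintro ⟨j, k⟩ i' hi'
      rcases List.mem_cons.1 hi' with rfl | hi'
      · simpa using huv k
      · have : i' ≠ i := fun e => hi (e ▸ hi')
        simpa [Function.update_of_ne this] using hpq j i' hi'
    · intro φ ψ h h'
      change (partialDeriv i)^[β i] (listDeriv β l (φ * ψ)) = _
      have hs : ∀ j, ContDiff ℝ (⊤ : ℕ∞) (listDeriv (p j) l φ * listDeriv (q j) l ψ) := fun j =>
        (contDiff_listDeriv (p j) l h).mul (contDiff_listDeriv (q j) l h')
      rw [hL φ ψ h h', partialDeriv_iterate_sum _ _ _ hs, Fintype.sum_prod_type]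
      refine Finset.sum_congr rfl fun j _ => ?_
      rw [hL' _ _ (contDiff_listDeriv (p j) l h) (contDiff_listDeriv (q j) l h')]
      refine Finset.sum_congr rfl fun k _ => ?_
      have e : ∀ (γ : Fin d → ℕ) (m : ℕ) (χ : EuclideanSpace ℝ (Fin d) → ℂ),
          listDeriv (Function.update γ i m) (i :: l) χ =
            (partialDeriv i)^[m] (listDeriv γ l χ) := fun γ m χ => by
        change (partialDeriv i)^[Function.update γ i m i] (listDeriv (Function.update γ i m) l χ) = _
        rw [Function.update_self, listDeriv_congr (γ := γ)]
        intro i' hi'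
        have : i' ≠ i := fun e => hi (e ▸ hi')
        exact Function.update_of_ne this _ _
      rw [e, e]

theorem norm_multiDeriv_le_of_gevreyNorm {s A : ℝ} {K : Set (EuclideanSpace ℝ (Fin d))}
    {φ : EuclideanSpace ℝ (Fin d) → ℂ} (hA : 0 < A) (h : gevreyNorm s A K φ < ∞) (β : Fin d → ℕ)
    {x : EuclideanSpace ℝ (Fin d)} (hx : x ∈ K) :
    A ^ (∑ i, β i) / ((∏ i, (β i).factorial : ℕ) : ℝ) ^ s * ‖multiDeriv β φ x‖ ≤
      (gevreyNorm s A K φ).toReal := by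
  rw [← ENNReal.ofReal_le_iff_le_toReal h.ne, ENNReal.ofReal_mul (by positivity), ofReal_norm]
  exact le_iSup_of_le (f := fun β : Fin d → ℕ => ⨆ x ∈ K, _) β (le_iSup₂_of_le x hx le_rfl)

theorem prod_factorial_pos (β : Fin d → ℕ) : (0 : ℝ) < ((∏ i, (β i).factorial : ℕ) : ℝ) := by
  exact_mod_cast Finset.prod_pos fun i _ => Nat.factorial_pos _

/-- The Leibniz sum has `2^|β|` terms, which passing from `A` to `A / 2` absorbs; in each term `p!
q! ≤ β!`, so the factorial weights are compatible without binomial coefficients. -/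
theorem mul_mem_gevreySpace {s : ℝ} (hs : 0 ≤ s) {φ ψ : EuclideanSpace ℝ (Fin d) → ℂ}
    (hφ : φ ∈ gevreySpace d s) (hψ : ψ ∈ gevreySpace d s) : φ * ψ ∈ gevreySpace d s := by
  refine ⟨hφ.1.mul hψ.1, fun K hK => ?_⟩
  obtain ⟨A₁, hA₁, hn₁⟩ := hφ.2 K hK
  obtain ⟨A₂, hA₂, hn₂⟩ := hψ.2 K hK
  set A := min A₁ A₂ with hA
  have hA0 : 0 < A := lt_min hA₁ hA₂
  have hn₁ := (gevreyNorm_mono s hA0.le (min_le_left _ _) K φ).trans_lt hn₁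
  have hn₂ := (gevreyNorm_mono s hA0.le (min_le_right _ _) K ψ).trans_lt hn₂
  set M₁ := (gevreyNorm s A K φ).toReal with hM₁
  set M₂ := (gevreyNorm s A K ψ).toReal with hM₂
  have hM₁0 : 0 ≤ M₁ := ENNReal.toReal_nonneg
  have hM₂0 : 0 ≤ M₂ := ENNReal.toReal_nonneg
  refine ⟨A / 2, by positivity, lt_of_le_of_lt (b := ENNReal.ofReal (M₁ * M₂)) ?_
    ENNReal.ofReal_lt_top⟩
  refine iSup_le fun β => iSup₂_le fun x hx => ?_
  rw [← ofReal_norm, ← ENNReal.ofReal_mul (by positivity)]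
  refine ENNReal.ofReal_le_ofReal ?_
  obtain ⟨ι, _, p, q, hc, hpq, hL⟩ := exists_listDeriv_mul β (List.finRange d)
    (List.nodup_finRange d)
  have hcard : (Fintype.card ι : ℝ) = 2 ^ (∑ i, β i) := by
    rw [hc, ← List.ofFn_eq_map, List.sum_ofFn]; push_cast; rfl
  have hterm : ∀ j, A ^ (∑ i, β i) / ((∏ i, (β i).factorial : ℕ) : ℝ) ^ s *
      ‖multiDeriv (p j) φ x * multiDeriv (q j) ψ x‖ ≤ M₁ * M₂ := by
    intro j
    have h1 := norm_multiDeriv_le_of_gevreyNorm hA0 hn₁ (p j) hx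
    have h2 := norm_multiDeriv_le_of_gevreyNorm hA0 hn₂ (q j) hx
    have hsum : ∑ i, β i = ∑ i, p j i + ∑ i, q j i := by
      rw [← Finset.sum_add_distrib]
      exact Finset.sum_congr rfl fun i _ => (hpq j i (List.mem_finRange i)).symm
    have hfac : ((∏ i, (p j i).factorial : ℕ) : ℝ) * ((∏ i, (q j i).factorial : ℕ) : ℝ) ≤
        ((∏ i, (β i).factorial : ℕ) : ℝ) := by
      rw [← Nat.cast_mul, ← Finset.prod_mul_distrib]
      refine Nat.cast_le.2 (Finset.prod_le_prod' fun i _ => ?_)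
      rw [← hpq j i (List.mem_finRange i)]
      exact Nat.le_of_dvd (Nat.factorial_pos _) (Nat.factorial_mul_factorial_dvd_factorial_add _ _)
    have hp := prod_factorial_pos (p j)
    have hq := prod_factorial_pos (q j)
    have hβ := prod_factorial_pos β
    calc _ ≤ A ^ (∑ i, β i) / (((∏ i, (p j i).factorial : ℕ) : ℝ) *
          ((∏ i, (q j i).factorial : ℕ) : ℝ)) ^ s *
          ‖multiDeriv (p j) φ x * multiDeriv (q j) ψ x‖ := by gcongr
      _ = (A ^ (∑ i, p j i) / ((∏ i, (p j i).factorial : ℕ) : ℝ) ^ s * ‖multiDeriv (p j) φ x‖) *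
          (A ^ (∑ i, q j i) / ((∏ i, (q j i).factorial : ℕ) : ℝ) ^ s *
            ‖multiDeriv (q j) ψ x‖) := by
        rw [Real.mul_rpow hp.le hq.le, norm_mul, hsum, pow_add]
        field_simp
      _ ≤ M₁ * M₂ := by gcongr
  have hβ := prod_factorial_pos β
  calc (A / 2) ^ (∑ i, β i) / ((∏ i, (β i).factorial : ℕ) : ℝ) ^ s * ‖multiDeriv β (φ * ψ) x‖
      ≤ (A / 2) ^ (∑ i, β i) / ((∏ i, (β i).factorial : ℕ) : ℝ) ^ s *
        ∑ j, ‖multiDeriv (p j) φ x * multiDeriv (q j) ψ x‖ := by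
        gcongr
        rw [multiDeriv, hL φ ψ hφ.1 hψ.1, Finset.sum_apply]
        exact norm_sum_le _ _
    _ = (1 / 2) ^ (∑ i, β i) * ∑ j, A ^ (∑ i, β i) / ((∏ i, (β i).factorial : ℕ) : ℝ) ^ s *
        ‖multiDeriv (p j) φ x * multiDeriv (q j) ψ x‖ := by
        rw [← Finset.mul_sum, div_pow, one_div, inv_pow]
        field_simp
    _ ≤ (1 / 2) ^ (∑ i, β i) * ∑ _j : ι, M₁ * M₂ := by
        exact mul_le_mul_of_nonneg_left (Finset.sum_le_sum fun j _ => hterm j) (by positivity)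
    _ = M₁ * M₂ := by
        rw [Finset.sum_const, Finset.card_univ, nsmul_eq_mul, hcard, ← mul_assoc, ← mul_pow]
        norm_num

end gevrey

/-- This is the `s`-th power of `z^n / n! ≤ e^z` at `z = y^{1/s}`. It converts factorial weights
into `exp(k |·|^{1/s})` throughout. -/
theorem pow_div_factorial_rpow_le {s y : ℝ} (hs : 0 < s) (hy : 0 ≤ y) (n : ℕ) :
    y ^ n / (n.factorial : ℝ) ^ s ≤ Real.exp (s * y ^ (1 / s)) := by
  have h1 : (y ^ (1 / s)) ^ n / n.factorial ≤ Real.exp (y ^ (1 / s)) :=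
    Real.pow_div_factorial_le_exp _ (by positivity) n
  have hf : (0 : ℝ) < n.factorial := by exact_mod_cast n.factorial_pos
  have h2 := Real.rpow_le_rpow (by positivity) h1 hs.le
  rw [Real.div_rpow (by positivity) hf.le, ← Real.exp_mul] at h2
  have h3 : ((y ^ (1 / s)) ^ n) ^ s = y ^ n := by
    rw [← Real.rpow_natCast, ← Real.rpow_mul hy, ← Real.rpow_mul hy, ← Real.rpow_natCast]
    congr 1; field_simp
  rwa [h3, mul_comm] at h2

/-! ### Series of exponentials in the Gevrey space and their images under ultradistributions. -/

section expSeries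

variable {d : ℕ}

theorem expFun_eq (η x : EuclideanSpace ℝ (Fin d)) : expFun η x = expNegI (inner ℝ x η) := rfl

@[simp] theorem norm_expFun (η x : EuclideanSpace ℝ (Fin d)) : ‖expFun η x‖ = 1 := by
  rw [expFun_eq, norm_expNegI]

/-- The left side factors over the coordinates, and each of the `d` factors is at most `exp(s
(A‖η‖)^{1/s})`. -/
theorem gevreyWeight_mul_prod_le {s A : ℝ} (hs : 0 < s) (hA : 0 ≤ A) (β : Fin d → ℕ)
    (η : EuclideanSpace ℝ (Fin d)) :
    A ^ (∑ i, β i) / ((∏ i, (β i).factorial : ℕ) : ℝ) ^ s * ∏ i, |η i| ^ β i ≤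
      Real.exp (d * s * A ^ (1 / s) * ‖η‖ ^ (1 / s)) := by
  have e : A ^ (∑ i, β i) / ((∏ i, (β i).factorial : ℕ) : ℝ) ^ s * ∏ i, |η i| ^ β i =
      ∏ i, (A * |η i|) ^ β i / ((β i).factorial : ℝ) ^ s := by
    rw [Finset.prod_div_distrib, Real.finsetProd_rpow _ _ (fun i _ => by positivity)]
    simp only [mul_pow]
    rw [Finset.prod_mul_distrib, Finset.prod_pow_eq_pow_sum]
    push_cast
    ring
  rw [e]
  calc _ ≤ ∏ _i : Fin d, Real.exp (s * (A * ‖η‖) ^ (1 / s)) := by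
        refine Finset.prod_le_prod (fun i _ => by positivity) fun i _ => ?_
        refine (pow_div_factorial_rpow_le hs (by positivity) _).trans ?_
        have := PiLp.norm_apply_le η i
        rw [Real.norm_eq_abs] at this
        gcongr
    _ = _ := by
        rw [Finset.prod_const, ← Real.exp_nat_mul, Real.mul_rpow hA (norm_nonneg _)]
        simp
        ring

theorem gevreyNorm_expFun_le {s A : ℝ} (hs : 0 < s) (hA : 0 ≤ A)
    (K : Set (EuclideanSpace ℝ (Fin d))) (η : EuclideanSpace ℝ (Fin d)) :
    gevreyNorm s A K (expFun η) ≤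
      ENNReal.ofReal (Real.exp (d * s * A ^ (1 / s) * ‖η‖ ^ (1 / s))) := by
  refine iSup_le fun β => iSup₂_le fun x _ => ?_
  rw [← ofReal_norm, norm_multiDeriv_expFun, ← ENNReal.ofReal_mul (by positivity)]
  exact ENNReal.ofReal_le_ofReal (gevreyWeight_mul_prod_le hs hA β η)

theorem norm_iteratedDeriv_expNegI (n : ℕ) (x : ℝ) : ‖iteratedDeriv n expNegI x‖ = 1 := by
  have h : iteratedDeriv n expNegI = fun x => (-Complex.I) ^ n * expNegI x := by
    induction n with
    | zero => simp
    | succ n ih =>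
      rw [iteratedDeriv_succ, ih]
      funext x
      have h1 : HasDerivAt expNegI (expNegI x * (-Complex.I * 1)) x :=
        ((Complex.ofRealCLM.hasDerivAt (x := x)).const_mul (-Complex.I)).cexp
      rw [(h1.const_mul _).deriv, pow_succ]
      ring
  rw [h]
  simp

theorem norm_iteratedFDeriv_expFun_le (n : ℕ) (η x : EuclideanSpace ℝ (Fin d)) :
    ‖iteratedFDeriv ℝ n (expFun η) x‖ ≤ ‖η‖ ^ n := by
  have e : expFun η = expNegI ∘ (innerSL ℝ η) := by
    funext y
    rw [expFun_eq, Function.comp_apply, innerSL_apply_apply, real_inner_comm]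
  rw [e, ContinuousLinearMap.iteratedFDeriv_comp_right _ contDiff_expNegI _ (i := n)
    (by exact_mod_cast le_top)]
  refine (ContinuousMultilinearMap.norm_compContinuousLinearMap_le _ _).trans ?_
  rw [norm_iteratedFDeriv_eq_norm_iteratedDeriv, norm_iteratedDeriv_expNegI, one_mul,
    Finset.prod_const, innerSL_apply_norm]
  simp

variable {ι : Type*}

/-- The sum of a series of exponentials with frequencies `η i` and coefficients `c i`. -/
noncomputable def expSeries (c : ι → ℂ) (η : ι → EuclideanSpace ℝ (Fin d)) :
    EuclideanSpace ℝ (Fin d) → ℂ := fun x => ∑' i, c i * expFun (η i) x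

theorem contDiff_expSeries {c : ι → ℂ} {η : ι → EuclideanSpace ℝ (Fin d)}
    (h : ∀ N : ℕ, Summable fun i => ‖c i‖ * ‖η i‖ ^ N) :
    ContDiff ℝ (⊤ : ℕ∞) (expSeries c η) := by
  refine contDiff_tsum (v := fun N i => ‖c i‖ * ‖η i‖ ^ N)
    (fun i => contDiff_const.mul (contDiff_expFun (η i))) (fun N _ => h N) fun N i x _ => ?_
  have e : (fun x => c i * expFun (η i) x) = c i • expFun (η i) := rfl
  rw [e, iteratedFDeriv_const_smul_apply ((contDiff_expFun (η i)).of_le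
    (by exact_mod_cast le_top)).contDiffAt, norm_smul]
  gcongr
  exact norm_iteratedFDeriv_expFun_le N _ _

theorem partialDeriv_expSeries {c : ι → ℂ} {η : ι → EuclideanSpace ℝ (Fin d)}
    (h : ∀ N : ℕ, Summable fun i => ‖c i‖ * ‖η i‖ ^ N) (j : Fin d) :
    partialDeriv j (expSeries c η) = expSeries (fun i => c i * (-Complex.I * (η i j : ℂ))) η := by
  funext x
  have hd : ∀ i y, HasFDerivAt (fun x => c i * expFun (η i) x) (c i • fderiv ℝ (expFun (η i)) y) y :=
    fun i y => ((contDiff_expFun (η i)).differentiable (by simp) y).hasFDerivAt.const_mul (c i)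
  have hbd : ∀ i y, ‖c i • fderiv ℝ (expFun (η i)) y‖ ≤ ‖c i‖ * ‖η i‖ ^ 1 := fun i y => by
    rw [norm_smul]
    gcongr
    have := norm_iteratedFDeriv_expFun_le 1 (η i) y
    rwa [← norm_iteratedFDeriv_fderiv, norm_iteratedFDeriv_zero] at this
  have h0 : Summable fun i => c i * expFun (η i) x :=
    Summable.of_norm (by simpa using h 0)
  have hF := hasFDerivAt_tsum (h 1) hd hbd h0 x
  have hs : Summable fun i => c i • fderiv ℝ (expFun (η i)) x :=
    Summable.of_norm_bounded (h 1) fun i => hbd i x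
  simp only [partialDeriv]
  rw [show expSeries c η = fun y => ∑' i, c i * expFun (η i) y from rfl, hF.fderiv]
  have h2 := (ContinuousLinearMap.apply ℝ ℂ (EuclideanSpace.single j (1 : ℝ))).map_tsum hs
  simp only [ContinuousLinearMap.apply_apply] at h2
  rw [h2]
  refine tsum_congr fun i => ?_
  have h3 := congrFun (partialDeriv_expFun j (η i)) x
  simp only [partialDeriv, Pi.smul_apply, smul_eq_mul] at h3
  rw [_root_.smul_apply, h3, smul_eq_mul]
  ring

theorem summable_moment_mul {c : ι → ℂ} {η : ι → EuclideanSpace ℝ (Fin d)}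
    (h : ∀ N : ℕ, Summable fun i => ‖c i‖ * ‖η i‖ ^ N) (j : Fin d) (n : ℕ) (N : ℕ) :
    Summable fun i => ‖c i * (-Complex.I * (η i j : ℂ)) ^ n‖ * ‖η i‖ ^ N := by
  refine Summable.of_nonneg_of_le (fun _ => by positivity) (fun i => ?_) (h (n + N))
  rw [norm_mul, norm_pow, pow_add, norm_mul, norm_neg, Complex.norm_I, one_mul, Complex.norm_real,
    ← mul_assoc]
  gcongr
  exact PiLp.norm_apply_le _ _

theorem partialDeriv_iterate_expSeries {c : ι → ℂ} {η : ι → EuclideanSpace ℝ (Fin d)}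
    (h : ∀ N : ℕ, Summable fun i => ‖c i‖ * ‖η i‖ ^ N) (j : Fin d) (n : ℕ) :
    (partialDeriv j)^[n] (expSeries c η) =
      expSeries (fun i => c i * (-Complex.I * (η i j : ℂ)) ^ n) η := by
  induction n with
  | zero => simp
  | succ n ih =>
    rw [Function.iterate_succ_apply', ih, partialDeriv_expSeries (summable_moment_mul h j n)]
    congr 1
    funext i
    ring

theorem listDeriv_expSeries {c : ι → ℂ} {η : ι → EuclideanSpace ℝ (Fin d)}
    (h : ∀ N : ℕ, Summable fun i => ‖c i‖ * ‖η i‖ ^ N) (β : Fin d → ℕ) (l : List (Fin d)) :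
    (∀ N : ℕ, Summable fun i =>
      ‖c i * (l.map fun j => (-Complex.I * (η i j : ℂ)) ^ β j).prod‖ * ‖η i‖ ^ N) ∧
    listDeriv β l (expSeries c η) =
      expSeries (fun i => c i * (l.map fun j => (-Complex.I * (η i j : ℂ)) ^ β j).prod) η := by
  induction l with
  | nil => simpa [listDeriv] using h
  | cons j l ih =>
    have e : ∀ i, c i * ((j :: l).map fun j => (-Complex.I * (η i j : ℂ)) ^ β j).prod =
        c i * (l.map fun j => (-Complex.I * (η i j : ℂ)) ^ β j).prod *
          (-Complex.I * (η i j : ℂ)) ^ β j := fun i => by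
      rw [List.map_cons, List.prod_cons]; ring
    simp only [e]
    refine ⟨fun N => summable_moment_mul ih.1 j (β j) N, ?_⟩
    change (partialDeriv j)^[β j] (listDeriv β l (expSeries c η)) = _
    rw [ih.2, partialDeriv_iterate_expSeries ih.1]

theorem summable_moment {s : ℝ} (hs : 0 < s) {c : ι → ℂ} {η : ι → EuclideanSpace ℝ (Fin d)}
    (h : ∀ k : ℝ, Summable fun i => ‖c i‖ * Real.exp (k * ‖η i‖ ^ (1 / s))) (N : ℕ) :
    Summable fun i => ‖c i‖ * ‖η i‖ ^ N := by
  refine Summable.of_nonneg_of_le (fun _ => by positivity) (fun i => ?_)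
    ((h s).mul_right ((N.factorial : ℝ) ^ s))
  have hf : (0 : ℝ) < N.factorial := by exact_mod_cast N.factorial_pos
  have := pow_div_factorial_rpow_le hs (norm_nonneg (η i)) N
  rw [div_le_iff₀ (by positivity)] at this
  rw [mul_assoc]
  gcongr

theorem gevreyNorm_expSeries_le {s A : ℝ} (hs : 0 < s) (hA : 0 ≤ A)
    (K : Set (EuclideanSpace ℝ (Fin d))) {c : ι → ℂ} {η : ι → EuclideanSpace ℝ (Fin d)}
    (h : ∀ k : ℝ, Summable fun i => ‖c i‖ * Real.exp (k * ‖η i‖ ^ (1 / s))) :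
    gevreyNorm s A K (expSeries c η) ≤
      ENNReal.ofReal (∑' i, ‖c i‖ * Real.exp (d * s * A ^ (1 / s) * ‖η i‖ ^ (1 / s))) := by
  refine iSup_le fun β => iSup₂_le fun x _ => ?_
  rw [← ofReal_norm, ← ENNReal.ofReal_mul (by positivity)]
  refine ENNReal.ofReal_le_ofReal ?_
  obtain ⟨hm, hL⟩ := listDeriv_expSeries (summable_moment hs h) β (List.finRange d)
  have hnorm : ∀ i, ‖c i * ((List.finRange d).map fun j => (-Complex.I * (η i j : ℂ)) ^ β j).prod‖ =
      ‖c i‖ * ∏ j, |η i j| ^ β j := fun i => by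
    rw [norm_mul, ← List.ofFn_eq_map, List.prod_ofFn]
    simp [norm_prod]
  have hm0 := hm 0
  simp only [pow_zero, mul_one, hnorm] at hm0
  have h1 : ‖multiDeriv β (expSeries c η) x‖ ≤ ∑' i, ‖c i‖ * ∏ j, |η i j| ^ β j := by
    rw [multiDeriv, hL]
    refine (norm_tsum_le_tsum_norm ?_).trans_eq (tsum_congr fun i => ?_)
    · simpa only [norm_mul _ (expFun _ _), norm_expFun, mul_one, hnorm] using hm0
    · rw [norm_mul _ (expFun _ _), norm_expFun, mul_one, hnorm]
  calc _ ≤ A ^ (∑ i, β i) / ((∏ i, (β i).factorial : ℕ) : ℝ) ^ s *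
        ∑' i, ‖c i‖ * ∏ j, |η i j| ^ β j := by gcongr
    _ = ∑' i, A ^ (∑ i, β i) / ((∏ i, (β i).factorial : ℕ) : ℝ) ^ s *
        (‖c i‖ * ∏ j, |η i j| ^ β j) := tsum_mul_left.symm
    _ ≤ _ := by
      refine Summable.tsum_le_tsum (fun i => ?_) (hm0.mul_left _) (h _)
      rw [mul_left_comm]
      exact mul_le_mul_of_nonneg_left (gevreyWeight_mul_prod_le hs hA β (η i)) (norm_nonneg _)

theorem expSeries_mem_gevreySpace {s : ℝ} (hs : 0 < s) {c : ι → ℂ}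
    {η : ι → EuclideanSpace ℝ (Fin d)}
    (h : ∀ k : ℝ, Summable fun i => ‖c i‖ * Real.exp (k * ‖η i‖ ^ (1 / s))) :
    expSeries c η ∈ gevreySpace d s :=
  ⟨contDiff_expSeries (summable_moment hs h), fun K _ => ⟨1, one_pos,
    (gevreyNorm_expSeries_le hs zero_le_one K h).trans_lt ENNReal.ofReal_lt_top⟩⟩

/-- An ultradistribution may be applied to a rapidly converging series of exponentials
term by term. -/
theorem GevreyDual.hasSum_expSeries {s : ℝ} (hs : 1 < s) (f : GevreyDual d s) {c : ι → ℂ}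
    {η : ι → EuclideanSpace ℝ (Fin d)}
    (h : ∀ k : ℝ, Summable fun i => ‖c i‖ * Real.exp (k * ‖η i‖ ^ (1 / s))) :
    HasSum (fun i => c i * f.toLinearMap ⟨expFun (η i), expFun_mem_gevreySpace hs (η i)⟩)
      (f.toLinearMap ⟨expSeries c η, expSeries_mem_gevreySpace (by linarith) h⟩) := by
  classical
  have hs0 : 0 < s := by linarith
  obtain ⟨K, hK, hf⟩ := f.continuous'
  obtain ⟨C, hC⟩ := hf 1 one_pos
  set u : ι → ℝ := fun i => ‖c i‖ * Real.exp (d * s * 1 ^ (1 / s) * ‖η i‖ ^ (1 / s)) with hu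
  have hus : Summable u := h _
  have hu0 : ∀ i, 0 ≤ u i := fun i => by positivity
  set P : gevreySpace d s := ⟨expSeries c η, expSeries_mem_gevreySpace hs0 h⟩ with hP
  set e : ι → gevreySpace d s := fun i => ⟨expFun (η i), expFun_mem_gevreySpace hs (η i)⟩ with he
  have key : ∀ F : Finset ι, ‖∑ i ∈ F, c i * f.toLinearMap (e i) - f.toLinearMap P‖ ≤
      C * (∑' i, u i - ∑ i ∈ F, u i) := by
    intro F
    -- The remainder after the partial sum over `F` is again an exponential series, with the
    -- coefficients in `F` deleted; its Gevrey norm is therefore bounded by the tail of `∑ u i`.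
    set c' : ι → ℂ := fun i => if i ∈ F then 0 else c i with hc'
    have hle : ∀ i, ‖c' i‖ ≤ ‖c i‖ := fun i => by
      simp only [hc']; split_ifs <;> simp
    have h' : ∀ k : ℝ, Summable fun i => ‖c' i‖ * Real.exp (k * ‖η i‖ ^ (1 / s)) := fun k =>
      Summable.of_nonneg_of_le (fun _ => by positivity) (fun i => by gcongr; exact hle i) (h k)
    have hsx : ∀ x, Summable fun i => c i * expFun (η i) x := fun x => by
      have := summable_moment hs0 h 0
      exact Summable.of_norm (by simpa using this)
    have hdiff : P - ∑ i ∈ F, c i • e i =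
        ⟨expSeries c' η, expSeries_mem_gevreySpace hs0 h'⟩ := by
      apply Subtype.ext
      funext x
      have e1 : ((P - ∑ i ∈ F, c i • e i : gevreySpace d s) : EuclideanSpace ℝ (Fin d) → ℂ) x =
          ∑' i, c i * expFun (η i) x - ∑ i ∈ F, c i * expFun (η i) x := by
        simp [hP, he, expSeries]
      rw [e1]
      simp only [expSeries]
      have e2 : ∑ i ∈ F, c i * expFun (η i) x =
          ∑' i, if i ∈ F then c i * expFun (η i) x else 0 := by
        rw [tsum_eq_sum (s := F) (fun i hi => by simp [hi])]
        exact Finset.sum_congr rfl fun i hi => by simp [hi]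
      rw [e2, ← (hsx x).tsum_sub (summable_of_ne_finset_zero (s := F) (fun i hi => by simp [hi]))]
      refine tsum_congr fun i => ?_
      simp only [hc']
      split_ifs <;> simp
    have h1 : f.toLinearMap P - ∑ i ∈ F, c i * f.toLinearMap (e i) =
        f.toLinearMap ⟨expSeries c' η, expSeries_mem_gevreySpace hs0 h'⟩ := by
      rw [← hdiff, map_sub, map_sum]
      simp
    have h2 : ∑' i, ‖c' i‖ * Real.exp (d * s * 1 ^ (1 / s) * ‖η i‖ ^ (1 / s)) =
        ∑' i, u i - ∑ i ∈ F, u i := by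
      have e2 : ∑ i ∈ F, u i = ∑' i, if i ∈ F then u i else 0 := by
        rw [tsum_eq_sum (s := F) (fun i hi => by simp [hi])]
        exact Finset.sum_congr rfl fun i hi => by simp [hi]
      rw [e2, ← hus.tsum_sub (summable_of_ne_finset_zero (s := F) (fun i hi => by simp [hi]))]
      refine tsum_congr fun i => ?_
      simp only [hc', hu]
      split_ifs <;> simp
    rw [norm_sub_rev, h1]
    have h3 := (hC ⟨expSeries c' η, expSeries_mem_gevreySpace hs0 h'⟩).trans
      (mul_le_mul_right (gevreyNorm_expSeries_le hs0 zero_le_one K h') (C : ℝ≥0∞))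
    rw [h2, ← ofReal_norm, ← ENNReal.ofReal_coe_nnreal, ← ENNReal.ofReal_mul C.coe_nonneg] at h3
    refine (ENNReal.ofReal_le_ofReal_iff ?_).1 h3
    refine mul_nonneg C.coe_nonneg (sub_nonneg.2 ?_)
    exact hus.sum_le_tsum F fun i _ => hu0 i
  rw [HasSum, tendsto_iff_norm_sub_tendsto_zero]
  refine squeeze_zero (fun _ => norm_nonneg _) key ?_
  have := (hus.hasSum.const_sub (∑' i, u i)).const_mul (C : ℝ)
  simpa using this

/-- The single norm with `A = 1` suffices: the expansion coefficients decay at every rate, so any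
finite growth rate of `f̂` is harmless. -/
theorem GevreyDual.norm_fourier_le {s : ℝ} (hs : 1 < s) (f : GevreyDual d s) :
    ∃ C k : ℝ, 0 ≤ C ∧ 0 ≤ k ∧ ∀ η, ‖f.fourier hs η‖ ≤ C * Real.exp (k * ‖η‖ ^ (1 / s)) := by
  have hs0 : 0 < s := by linarith
  obtain ⟨K, hK, hf⟩ := f.continuous'
  obtain ⟨C, hC⟩ := hf 1 one_pos
  set a : ℝ := (2 * Real.pi) ^ (-(d : ℝ) / 2) with ha
  have ha0 : 0 ≤ a := by positivity
  refine ⟨a * C, d * s * 1 ^ (1 / s), by positivity, by positivity, fun η => ?_⟩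
  rw [GevreyDual.fourier, norm_mul, Complex.norm_real, Real.norm_eq_abs, abs_of_nonneg ha0,
    mul_assoc]
  refine mul_le_mul_of_nonneg_left ?_ ha0
  have h3 := (hC ⟨expFun η, expFun_mem_gevreySpace hs η⟩).trans
    (mul_le_mul_right (gevreyNorm_expFun_le hs0 zero_le_one K η) (C : ℝ≥0∞))
  rw [← ofReal_norm, ← ENNReal.ofReal_coe_nnreal, ← ENNReal.ofReal_mul C.coe_nonneg] at h3
  exact (ENNReal.ofReal_le_ofReal_iff (by positivity)).1 h3

end expSeries

/-- This turns one-variable expansions into `d`-variable ones; absolute convergence allows the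
product to be multiplied out, one coordinate at a time. -/
theorem hasSum_pi_prod {ι 𝕜 : Type*} [NormedField 𝕜] [CompleteSpace 𝕜] {d : ℕ}
    {g : Fin d → ι → 𝕜} {a : Fin d → 𝕜} (h : ∀ j, HasSum (g j) (a j))
    (h' : ∀ j, Summable fun i => ‖g j i‖) :
    HasSum (fun n : Fin d → ι => ∏ j, g j (n j)) (∏ j, a j) ∧
      Summable fun n : Fin d → ι => ‖∏ j, g j (n j)‖ := by
  induction d with
  | zero => exact ⟨by simp, (hasSum_fintype _).summable⟩
  | succ d ih =>
    obtain ⟨h1, h1'⟩ := ih (fun j => h j.succ) fun j => h' j.succ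
    have h2 : Summable fun x : ι × (Fin d → ι) => ‖g 0 x.1 * ∏ j, g (Fin.succ j) (x.2 j)‖ := by
      set p : (Fin d → ι) → 𝕜 := fun n => ∏ j, g (Fin.succ j) (n j)
      exact Summable.mul_norm (f := g 0) (g := p) (h' 0) h1'
    have h3 : HasSum (fun x : ι × (Fin d → ι) => g 0 x.1 * ∏ j, g (Fin.succ j) (x.2 j))
        (a 0 * ∏ j : Fin d, a j.succ) := by
      set p : (Fin d → ι) → 𝕜 := fun n => ∏ j, g (Fin.succ j) (n j)
      exact HasSum.mul (f := g 0) (g := p) (h 0) h1 h2.of_norm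
    have e : ∀ x : ι × (Fin d → ι), ∏ j, g j (Fin.consEquiv (fun _ : Fin (d + 1) => ι) x j) =
        g 0 x.1 * ∏ j, g (Fin.succ j) (x.2 j) := fun x => by
      rw [Fin.prod_univ_succ]; rfl
    constructor
    · rw [← Equiv.hasSum_iff (Fin.consEquiv fun _ : Fin (d + 1) => ι)]
      exact h3.of_eq e (Fin.prod_univ_succ _)
    · rw [← Equiv.summable_iff (Fin.consEquiv fun _ : Fin (d + 1) => ι)]
      exact h2.congr fun x => by rw [Function.comp_apply, e]

/-! ### Vanishing of an ultradistribution away from its support. -/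

section vanishing

variable {d : ℕ}

theorem one_mem_gevreySpace {s : ℝ} (hs : 1 < s) :
    (1 : EuclideanSpace ℝ (Fin d) → ℂ) ∈ gevreySpace d s := by
  have h := expFun_mem_gevreySpace hs (0 : EuclideanSpace ℝ (Fin d))
  have e : expFun (0 : EuclideanSpace ℝ (Fin d)) = 1 := by
    funext x; simp [expFun]
  rwa [e] at h

/-- An ultradistribution vanishes on the test functions which vanish near its support. -/
theorem GevreyDual.apply_eq_zero {s : ℝ} (hs : 1 < s)
    (hbump : ∀ (x : EuclideanSpace ℝ (Fin d)) (V : Set (EuclideanSpace ℝ (Fin d))), IsOpen V →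
      x ∈ V → ∃ χ ∈ gevreySpace d s, HasCompactSupport χ ∧ tsupport χ ⊆ V ∧ χ =ᶠ[𝓝 x] 1)
    (f : GevreyDual d s) (ψ : gevreySpace d s)
    (hψ : ∀ x ∈ f.support, (ψ : EuclideanSpace ℝ (Fin d) → ℂ) =ᶠ[𝓝 x] 0) :
    f.toLinearMap ψ = 0 := by
  have hs0 : 0 ≤ s := by linarith
  obtain ⟨K, hK, hf⟩ := f.continuous'
  -- At a point of the support `χ` lives where `ψ` vanishes, so the product is zero; elsewhere `χ`
  -- lives in an open set on which `f` vanishes.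
  have hloc : ∀ x : EuclideanSpace ℝ (Fin d), ∃ χ ∈ gevreySpace d s, χ =ᶠ[𝓝 x] 1 ∧
      ∀ g : gevreySpace d s, ∀ h : χ * ((g : EuclideanSpace ℝ (Fin d) → ℂ) * ψ) ∈ gevreySpace d s,
        f.toLinearMap ⟨_, h⟩ = 0 := by
    intro x
    by_cases hx : x ∈ f.support
    · obtain ⟨V, hV, hVo, hxV⟩ := eventually_nhds_iff.1 (hψ x hx)
      obtain ⟨χ, hχ, -, hχV, hχ1⟩ := hbump x V hVo hxV
      refine ⟨χ, hχ, hχ1, fun g h => ?_⟩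
      have e : (⟨_, h⟩ : gevreySpace d s) = 0 := by
        apply Subtype.ext
        funext y
        by_cases hy : y ∈ V
        · simp [hV y hy]
        · have : χ y = 0 := image_eq_zero_of_notMem_tsupport fun h => hy (hχV h)
          simp [this]
      rw [e, map_zero]
    · simp only [GevreyDual.support, Set.mem_ofPred_eq, not_forall, not_exists, not_and,
        not_not] at hx
      obtain ⟨U, hUo, hxU, hU⟩ := hx
      obtain ⟨χ, hχ, hχc, hχV, hχ1⟩ := hbump x U hUo hxU
      exact ⟨χ, hχ, hχ1, fun g h => hU ⟨_, h⟩ hχc.mul_right ((tsupport_mul_subset_left).trans hχV)⟩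
  choose χ hχ hχ1 hχ0 using hloc
  obtain ⟨t, -, ht⟩ := hK.elim_nhds_subcover (fun x => {y | χ x =ᶠ[𝓝 y] 1})
    (fun x _ => eventually_eventually_nhds.2 (hχ1 x))
  -- Here `g` is the product of the `1 - χ x` over `x ∈ t`. Multiplying `ψ` by it does not change
  -- the value of `f`, while for a finite cover of `K` it kills `ψ` near `K`, so the bounding norm
  -- is 0.
  have key : ∀ t : Finset (EuclideanSpace ℝ (Fin d)), ∃ g : gevreySpace d s,
      f.toLinearMap ⟨_, mul_mem_gevreySpace hs0 g.2 ψ.2⟩ = f.toLinearMap ψ ∧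
      ∀ x ∈ t, ∀ y, χ x y = 1 → (g : EuclideanSpace ℝ (Fin d) → ℂ) y = 0 := by
    intro t
    classical
    induction t using Finset.induction_on with
    | empty =>
      refine ⟨⟨1, one_mem_gevreySpace hs⟩, ?_, by simp⟩
      congr 1
      apply Subtype.ext
      simp
    | insert a t ha ih =>
      obtain ⟨g, hg, hg0⟩ := ih
      refine ⟨g - ⟨_, mul_mem_gevreySpace hs0 (hχ a) g.2⟩, ?_, ?_⟩
      · have h1 := hχ0 a g (mul_mem_gevreySpace hs0 (hχ a) (mul_mem_gevreySpace hs0 g.2 ψ.2))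
        rw [← hg]
        conv_rhs => rw [← sub_zero (f.toLinearMap _), ← h1, ← map_sub]
        congr 1
        apply Subtype.ext
        funext y
        simp
        ring
      · intro x hx y hy
        rcases Finset.mem_insert.1 hx with rfl | hx
        · simp [hy]
        · simp [hg0 x hx y hy]
  obtain ⟨g, hg, hg0⟩ := key t
  rw [← hg]
  obtain ⟨C, hC⟩ := hf 1 one_pos
  have h1 := hC ⟨_, mul_mem_gevreySpace hs0 g.2 ψ.2⟩
  rw [gevreyNorm_eq_zero, mul_zero] at h1
  · simpa using h1
  · intro y hy
    obtain ⟨x, hx, hxy⟩ := Set.mem_iUnion₂.1 (ht hy)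
    have hxy : χ x =ᶠ[𝓝 y] 1 := hxy
    filter_upwards [hxy] with z hz
    simp [hg0 x hx z hz]

end vanishing

/-! ### Lattice sums and decay in lattice coordinates. -/

section lattice

theorem rpow_inv_subadd {s a b : ℝ} (hs : 1 < s) (ha : 0 ≤ a) (hb : 0 ≤ b) :
    (a + b) ^ (1 / s) ≤ a ^ (1 / s) + b ^ (1 / s) :=
  Real.rpow_add_le_add_rpow ha hb (by positivity) (by rw [div_le_one (by linarith)]; exact hs.le)

theorem norm_rpow_add_le {V : Type*} [NormedAddCommGroup V] {s : ℝ} (hs : 1 < s) (x y : V) :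
    ‖x + y‖ ^ (1 / s) ≤ ‖x‖ ^ (1 / s) + ‖y‖ ^ (1 / s) :=
  (Real.rpow_le_rpow (norm_nonneg _) (norm_add_le x y) (by positivity)).trans
    (rpow_inv_subadd hs (norm_nonneg _) (norm_nonneg _))

theorem summable_exp_neg_rpow_int {s c : ℝ} (hs : 0 < s) (hc : 0 < c) :
    Summable fun n : ℤ => Real.exp (-(c * |(n : ℝ)| ^ (1 / s))) := by
  set D : ℝ := (c / s) ^ s with hD
  have hD0 : 0 < D := by positivity
  have h2 : Summable fun n : ℤ => ((2 : ℕ).factorial : ℝ) ^ s / D ^ 2 * (1 / (n : ℝ) ^ 2) :=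
    (Real.summable_one_div_int_pow.2 one_lt_two).mul_left _
  refine Summable.of_norm_bounded_eventually h2 ?_
  filter_upwards [(Set.finite_singleton (0 : ℤ)).compl_mem_cofinite] with n hn
  have hn0 : (n : ℝ) ≠ 0 := by exact_mod_cast hn
  have hn1 : 0 < |(n : ℝ)| := abs_pos.2 hn0
  have h := pow_div_factorial_rpow_le hs (y := D * |(n : ℝ)|) (by positivity) 2
  have e : s * (D * |(n : ℝ)|) ^ (1 / s) = c * |(n : ℝ)| ^ (1 / s) := by
    rw [Real.mul_rpow hD0.le (abs_nonneg _), hD, ← Real.rpow_mul (by positivity),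
      mul_one_div_cancel hs.ne', Real.rpow_one]
    field_simp
  rw [e, mul_pow, sq_abs] at h
  rw [Real.norm_eq_abs, Real.abs_exp, Real.exp_neg]
  have h3 := inv_anti₀ (by positivity) h
  refine h3.trans_eq ?_
  field_simp

variable {d : ℕ} {E : Type*} [NormedAddCommGroup E] [NormedSpace ℝ E]

/-- The lattice point with integer coordinates `n` in the basis `ε`. -/
noncomputable def latticePoint (ε : Module.Basis (Fin d) ℝ E) (n : Fin d → ℤ) : E :=
  ∑ j, (n j : ℝ) • ε j

theorem repr_latticePoint (ε : Module.Basis (Fin d) ℝ E) (n : Fin d → ℤ) (j : Fin d) :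
    ε.repr (latticePoint ε n) j = n j := by
  rw [latticePoint, Module.Basis.repr_sum_self]

theorem latticePoint_sub (ε : Module.Basis (Fin d) ℝ E) (n m : Fin d → ℤ) :
    latticePoint ε (n - m) = latticePoint ε n - latticePoint ε m := by
  simp [latticePoint, sub_smul]

theorem latticePoint_injective (ε : Module.Basis (Fin d) ℝ E) :
    Function.Injective (latticePoint ε) := fun n m h => by
  funext j
  have := congrArg (fun x => ε.repr x j) h
  simpa only [repr_latticePoint, Int.cast_inj] using this

theorem exists_repr_abs_le (ε : Module.Basis (Fin d) ℝ E) :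
    ∃ M : ℝ, 0 < M ∧ ∀ x j, |ε.repr x j| ≤ M * ‖x‖ := by
  have : FiniteDimensional ℝ E := ε.finiteDimensional_of_finite
  set L := ε.equivFunL with hL
  refine ⟨‖(L : E →L[ℝ] (Fin d → ℝ))‖ + 1, by positivity, fun x j => ?_⟩
  have h1 : |ε.repr x j| ≤ ‖L x‖ := norm_le_pi_norm (L x) j
  refine h1.trans (((L : E →L[ℝ] (Fin d → ℝ)).le_opNorm x).trans ?_)
  gcongr
  linarith

theorem norm_le_sum_repr (ε : Module.Basis (Fin d) ℝ E) (x : E) :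
    ‖x‖ ≤ ∑ j, |ε.repr x j| * ‖ε j‖ := by
  conv_lhs => rw [← ε.sum_repr x]
  refine (norm_sum_le _ _).trans_eq (Finset.sum_congr rfl fun j _ => ?_)
  rw [norm_smul, Real.norm_eq_abs]

/-- The sums of `exp(-‖ξ - η‖^{1/s})` over the lattice points `η` are bounded uniformly in `ξ`. -/
theorem exists_tsum_exp_neg_le {s : ℝ} (hs : 1 < s) (ε : Module.Basis (Fin d) ℝ E) :
    ∃ S : ℝ, ∀ ξ : E, (Summable fun n => Real.exp (-‖ξ - latticePoint ε n‖ ^ (1 / s))) ∧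
      ∑' n, Real.exp (-‖ξ - latticePoint ε n‖ ^ (1 / s)) ≤ S := by
  have hs0 : 0 < s := by linarith
  obtain ⟨M, hM, hrepr⟩ := exists_repr_abs_le ε
  -- With `d + 1` instead of `d` the constant is positive also when `d = 0`.
  set c : ℝ := ((d + 1) * M ^ (1 / s))⁻¹ with hc
  have hc0 : 0 < c := by positivity
  have h0 : Summable fun n => Real.exp (-‖latticePoint ε n‖ ^ (1 / s)) := by
    have h1 := (hasSum_pi_prod (d := d) (fun _ => (summable_exp_neg_rpow_int hs0 hc0).hasSum)
      fun _ => (summable_exp_neg_rpow_int hs0 hc0).norm).1.summable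
    refine Summable.of_nonneg_of_le (fun _ => (Real.exp_pos _).le) (fun n => ?_) h1
    rw [← Real.exp_sum]
    refine Real.exp_le_exp.2 ?_
    rw [Finset.sum_neg_distrib, neg_le_neg_iff, ← Finset.mul_sum, hc, inv_mul_le_iff₀ (by positivity)]
    calc ∑ j, |(n j : ℝ)| ^ (1 / s) ≤ ∑ _j : Fin d, M ^ (1 / s) * ‖latticePoint ε n‖ ^ (1 / s) := by
          refine Finset.sum_le_sum fun j _ => ?_
          rw [← Real.mul_rpow hM.le (norm_nonneg _)]
          refine Real.rpow_le_rpow (abs_nonneg _) ?_ (by positivity)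
          rw [← repr_latticePoint ε n j]
          exact hrepr _ _
      _ = d * M ^ (1 / s) * ‖latticePoint ε n‖ ^ (1 / s) := by
          simp; ring
      _ ≤ _ := by gcongr; linarith
  set R : ℝ := (∑ j, ‖ε j‖) ^ (1 / s) with hR
  refine ⟨Real.exp R * ∑' n, Real.exp (-‖latticePoint ε n‖ ^ (1 / s)), fun ξ => ?_⟩
  -- Translation by a lattice point brings `ξ` into the fundamental cell at the cost of the factor
  -- `exp R`; the shift disappears on reindexing the sum.
  set m : Fin d → ℤ := fun j => ⌊ε.repr ξ j⌋ with hm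
  have hξ : ‖ξ - latticePoint ε m‖ ^ (1 / s) ≤ R := by
    refine Real.rpow_le_rpow (norm_nonneg _) ?_ (by positivity)
    refine (norm_le_sum_repr ε _).trans (Finset.sum_le_sum fun j _ => ?_)
    refine mul_le_of_le_one_left (norm_nonneg _) ?_
    rw [map_sub, Finsupp.sub_apply, repr_latticePoint, hm, Int.self_sub_floor,
      abs_of_nonneg (Int.fract_nonneg _)]
    exact (Int.fract_lt_one _).le
  have hle : ∀ n, Real.exp (-‖ξ - latticePoint ε n‖ ^ (1 / s)) ≤
      Real.exp R * Real.exp (-‖latticePoint ε (n - m)‖ ^ (1 / s)) := fun n => by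
    rw [← Real.exp_add]
    refine Real.exp_le_exp.2 ?_
    have h1 := norm_rpow_add_le hs (ξ - latticePoint ε m) (latticePoint ε n - ξ)
    have e : ξ - latticePoint ε m + (latticePoint ε n - ξ) = latticePoint ε (n - m) := by
      rw [latticePoint_sub]; abel
    rw [e, norm_sub_rev (latticePoint ε n)] at h1
    linarith
  have h2 : Summable fun n => Real.exp R * Real.exp (-‖latticePoint ε (n - m)‖ ^ (1 / s)) :=
    ((Equiv.subRight m).summable_iff.2 h0).mul_left _
  refine ⟨Summable.of_nonneg_of_le (fun _ => (Real.exp_pos _).le) hle h2, ?_⟩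
  refine (Summable.tsum_le_tsum hle
    (Summable.of_nonneg_of_le (fun _ => (Real.exp_pos _).le) hle h2) h2).trans_eq ?_
  rw [tsum_mul_left]
  congr 1
  exact (Equiv.subRight m).tsum_eq fun n => Real.exp (-‖latticePoint ε n‖ ^ (1 / s))

/-- Products of rapidly decaying functions of the coordinates decay rapidly. -/
theorem exists_prod_decay {s : ℝ} (hs : 1 < s) (ε : Module.Basis (Fin d) ℝ E) {b : ℝ → ℂ}
    (hb : ∀ h : ℝ, ∃ C : ℝ, ∀ x, ‖b x‖ ≤ C * Real.exp (-h * |x| ^ (1 / s))) (h : ℝ) :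
    ∃ C : ℝ, 0 ≤ C ∧ ∀ x : E, ‖∏ j, b (ε.repr x j)‖ ≤ C * Real.exp (-h * ‖x‖ ^ (1 / s)) := by
  set Q : ℝ := (∑ j, ‖ε j‖) ^ (1 / s) with hQ
  have hQ0 : 0 ≤ Q := by positivity
  -- Since `‖x‖^{1/s}` is at most `Q` times the sum of the `|x_j|^{1/s}`, the rate `|h| Q` in each
  -- coordinate gives the rate `h` in the norm.
  obtain ⟨C, hC⟩ := hb (|h| * Q)
  have hC0 : 0 ≤ C := by
    have h1 := (norm_nonneg _).trans (hC 0)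
    exact nonneg_of_mul_nonneg_left h1 (Real.exp_pos _)
  refine ⟨C ^ d, by positivity, fun x => ?_⟩
  have hx : ‖x‖ ^ (1 / s) ≤ Q * ∑ j, |ε.repr x j| ^ (1 / s) := by
    set Y : ℝ := ∑ j, |ε.repr x j| ^ (1 / s) with hY
    have hY0 : 0 ≤ Y := Finset.sum_nonneg fun j _ => by positivity
    have hj : ∀ j, |ε.repr x j| ≤ Y ^ s := fun j => by
      have h1 : |ε.repr x j| ^ (1 / s) ≤ Y :=
        Finset.single_le_sum (f := fun j => |ε.repr x j| ^ (1 / s))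
          (fun j _ => by positivity) (Finset.mem_univ j)
      have h2 := Real.rpow_le_rpow (by positivity) h1 (by linarith : 0 ≤ s)
      rwa [← Real.rpow_mul (abs_nonneg _), one_div_mul_cancel (by linarith), Real.rpow_one] at h2
    have h3 : ‖x‖ ≤ (∑ j, ‖ε j‖) * Y ^ s := by
      rw [Finset.sum_mul]
      refine (norm_le_sum_repr ε x).trans (Finset.sum_le_sum fun j _ => ?_)
      rw [mul_comm]
      exact mul_le_mul_of_nonneg_left (hj j) (norm_nonneg _)
    have h4 := Real.rpow_le_rpow (norm_nonneg _) h3 (by positivity : 0 ≤ 1 / s)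
    rwa [Real.mul_rpow (by positivity) (by positivity), ← Real.rpow_mul hY0,
      mul_one_div_cancel (by linarith), Real.rpow_one] at h4
  rw [norm_prod]
  calc ∏ j, ‖b (ε.repr x j)‖
      ≤ ∏ j, (C * Real.exp (-(|h| * Q) * |ε.repr x j| ^ (1 / s))) :=
        Finset.prod_le_prod (fun _ _ => norm_nonneg _) fun j _ => hC _
    _ = C ^ d * Real.exp (-(|h| * (Q * ∑ j, |ε.repr x j| ^ (1 / s)))) := by
        rw [Finset.prod_mul_distrib, ← Real.exp_sum, ← Finset.mul_sum]
        simp [mul_assoc]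
    _ ≤ _ := by
        gcongr
        rw [neg_mul, neg_le_neg_iff]
        exact (mul_le_mul_of_nonneg_right (le_abs_self h) (by positivity)).trans
          (mul_le_mul_of_nonneg_left hx (abs_nonneg h))

end lattice

/-! ### Window expansions in several variables and recovery of the Fourier transform from a lattice.
-/

section window

variable {d : ℕ}

/-- The coefficients, along the lattice spanned by `ε`, of the expansion of the windowed
exponential of frequency `ξ`; the window is positioned at `y₀`. -/
noncomputable def windowCoeff (b : ℝ → ℂ) (ε : Module.Basis (Fin d) ℝ (EuclideanSpace ℝ (Fin d)))
    (y₀ ξ : EuclideanSpace ℝ (Fin d)) (n : Fin d → ℤ) : ℂ :=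
  (∏ j, b (n j - ε.repr ξ j)) * expNegI (inner ℝ y₀ (ξ - latticePoint ε n))

theorem inner_eq_sum_repr (ε : Module.Basis (Fin d) ℝ (EuclideanSpace ℝ (Fin d)))
    (x ξ : EuclideanSpace ℝ (Fin d)) :
    inner ℝ x ξ = ∑ j, 2 * Real.pi * (ε.repr ξ j * (inner ℝ x (ε j) / (2 * Real.pi))) := by
  conv_lhs => rw [← ε.sum_repr ξ]
  rw [inner_sum]
  refine Finset.sum_congr rfl fun j _ => ?_
  rw [real_inner_smul_right]
  have := Real.pi_ne_zero
  field_simp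

/-- The one-variable expansions in `⟨x - y₀, ε_j⟩ / 2π` are multiplied together; the phase in
`windowCoeff` accounts for the origin being moved to `y₀`. -/
theorem hasSum_windowCoeff {b : ℝ → ℂ} {ε : Module.Basis (Fin d) ℝ (EuclideanSpace ℝ (Fin d))}
    {y₀ ξ x : EuclideanSpace ℝ (Fin d)} {a : Fin d → ℂ}
    (h : ∀ j, HasSum (fun n : ℤ => b (n - ε.repr ξ j) *
      expNegI (2 * Real.pi * (n * (inner ℝ (x - y₀) (ε j) / (2 * Real.pi))))) (a j)) :
    HasSum (fun n => windowCoeff b ε y₀ ξ n * expFun (latticePoint ε n) x)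
      (expNegI (inner ℝ y₀ ξ) * ∏ j, a j) := by
  refine ((hasSum_pi_prod h fun j => (h j).summable.norm).1.mul_left _).of_eq (fun n => ?_) rfl
  rw [Finset.prod_mul_distrib, ← expNegI_sum, windowCoeff, expFun_eq]
  have e1 : ∑ j, 2 * Real.pi * ((n j : ℝ) * (inner ℝ (x - y₀) (ε j) / (2 * Real.pi))) =
      inner ℝ (x - y₀) (latticePoint ε n) := by
    rw [inner_eq_sum_repr ε]
    simp only [repr_latticePoint]
  rw [e1]
  have e2 : inner ℝ y₀ (ξ - latticePoint ε n) + inner ℝ x (latticePoint ε n) =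
      inner ℝ y₀ ξ + inner ℝ (x - y₀) (latticePoint ε n) := by
    rw [inner_sub_right, inner_sub_left]; ring
  have e3 := congrArg expNegI e2
  rw [expNegI_add, expNegI_add] at e3
  rw [mul_assoc, e3]
  ring

theorem exists_norm_windowCoeff_le {s : ℝ} (hs : 1 < s) {b : ℝ → ℂ}
    (hb : ∀ h : ℝ, ∃ C : ℝ, ∀ x, ‖b x‖ ≤ C * Real.exp (-h * |x| ^ (1 / s)))
    (ε : Module.Basis (Fin d) ℝ (EuclideanSpace ℝ (Fin d))) (y₀ : EuclideanSpace ℝ (Fin d))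
    (h : ℝ) : ∃ C : ℝ, 0 ≤ C ∧ ∀ ξ n, ‖windowCoeff b ε y₀ ξ n‖ ≤
      C * Real.exp (-h * ‖ξ - latticePoint ε n‖ ^ (1 / s)) := by
  obtain ⟨C, hC, h1⟩ := exists_prod_decay hs ε hb h
  refine ⟨C, hC, fun ξ n => ?_⟩
  rw [windowCoeff, norm_mul, norm_expNegI, mul_one, norm_sub_rev]
  have h2 := h1 (latticePoint ε n - ξ)
  simpa only [map_sub, Finsupp.sub_apply, repr_latticePoint] using h2

theorem summable_windowCoeff {s : ℝ} (hs : 1 < s) {b : ℝ → ℂ}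
    (hb : ∀ h : ℝ, ∃ C : ℝ, ∀ x, ‖b x‖ ≤ C * Real.exp (-h * |x| ^ (1 / s)))
    (ε : Module.Basis (Fin d) ℝ (EuclideanSpace ℝ (Fin d))) (y₀ ξ : EuclideanSpace ℝ (Fin d))
    (k : ℝ) : Summable fun n =>
      ‖windowCoeff b ε y₀ ξ n‖ * Real.exp (k * ‖latticePoint ε n‖ ^ (1 / s)) := by
  -- The part `|k|` of the rate pays for the exponential weight, by subadditivity of `|·|^{1/s}`;
  -- the part 1 makes the series converge.
  obtain ⟨C, hC, h1⟩ := exists_norm_windowCoeff_le hs hb ε y₀ (|k| + 1)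
  obtain ⟨S, hS⟩ := exists_tsum_exp_neg_le hs ε
  refine Summable.of_nonneg_of_le (fun _ => by positivity) (fun n => ?_)
    ((hS ξ).1.mul_left (C * Real.exp (|k| * ‖ξ‖ ^ (1 / s))))
  set y := ‖ξ - latticePoint ε n‖ ^ (1 / s) with hy
  have h2 : ‖latticePoint ε n‖ ^ (1 / s) ≤ y + ‖ξ‖ ^ (1 / s) := by
    have := norm_rpow_add_le hs (latticePoint ε n - ξ) ξ
    rwa [sub_add_cancel, norm_sub_rev] at this
  have h3 : k * ‖latticePoint ε n‖ ^ (1 / s) ≤ |k| * y + |k| * ‖ξ‖ ^ (1 / s) := by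
    rw [← mul_add]
    exact (mul_le_mul_of_nonneg_right (le_abs_self k) (by positivity)).trans
      (mul_le_mul_of_nonneg_left h2 (abs_nonneg k))
  calc _ ≤ C * Real.exp (-(|k| + 1) * y) * Real.exp (|k| * y + |k| * ‖ξ‖ ^ (1 / s)) := by
        gcongr
        exact h1 ξ n
    _ = _ := by
        rw [mul_assoc, mul_assoc, ← Real.exp_add, ← Real.exp_add]
        congr 2; ring

theorem prod_expNegI_eq (ε : Module.Basis (Fin d) ℝ (EuclideanSpace ℝ (Fin d)))
    (y₀ ξ x : EuclideanSpace ℝ (Fin d)) :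
    expNegI (inner ℝ y₀ ξ) *
      ∏ j, expNegI (2 * Real.pi * (ε.repr ξ j * (inner ℝ (x - y₀) (ε j) / (2 * Real.pi)))) =
      expFun ξ x := by
  rw [← expNegI_sum, ← inner_eq_sum_repr, ← expNegI_add, ← inner_add_left, expFun_eq,
    add_sub_cancel]

theorem norm_le_sum_abs (x : EuclideanSpace ℝ (Fin d)) : ‖x‖ ≤ ∑ j, |x j| := by
  have h := norm_le_sum_repr (EuclideanSpace.basisFun (Fin d) ℝ).toBasis x
  simpa using h

/-- Compactly supported Gevrey bump functions exist near every point. -/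
theorem exists_gevrey_bump {s : ℝ} (hs : 1 < s) (x₀ : EuclideanSpace ℝ (Fin d))
    (V : Set (EuclideanSpace ℝ (Fin d))) (hV : IsOpen V) (hx₀ : x₀ ∈ V) :
    ∃ χ ∈ gevreySpace d s, HasCompactSupport χ ∧ tsupport χ ⊆ V ∧ χ =ᶠ[𝓝 x₀] 1 := by
  obtain ⟨b, hb, hb1, hb0⟩ := exists_fourier_window hs (r := 1 / 8) (R := 1 / 4)
    (by norm_num) (by norm_num) (by norm_num)
  obtain ⟨r, hr, hrV⟩ := Metric.isOpen_iff.1 hV x₀ hx₀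
  set R : ℝ := r / (d + 1) with hR
  have hR0 : 0 < R := by positivity
  have hunit : ∀ _j : Fin d, IsUnit (2 * Real.pi / R) := fun _ =>
    IsUnit.mk0 _ (by have := Real.pi_pos; positivity)
  set ε : Module.Basis (Fin d) ℝ (EuclideanSpace ℝ (Fin d)) :=
    (EuclideanSpace.basisFun (Fin d) ℝ).toBasis.isUnitSMul hunit with hε
  -- This puts `x₀` at the centre of the period cell, where every `t j` equals 1/2.
  set y₀ : EuclideanSpace ℝ (Fin d) := x₀ - WithLp.toLp 2 fun _ => R / 2 with hy₀
  set t : Fin d → EuclideanSpace ℝ (Fin d) → ℝ :=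
    fun j x => inner ℝ (x - y₀) (ε j) / (2 * Real.pi) with ht
  have ht' : ∀ j x, t j x - 1 / 2 = (x j - x₀ j) / R := fun j x => by
    simp only [ht, hε, Module.Basis.isUnitSMul_apply, OrthonormalBasis.coe_toBasis,
      EuclideanSpace.basisFun_apply, real_inner_smul_right, EuclideanSpace.inner_single_right, hy₀]
    have := Real.pi_ne_zero
    simp
    field_simp
    ring
  have htc : ∀ j, Continuous (t j) := fun j => by
    have : t j = fun x => (x j - x₀ j) / R + 1 / 2 := by
      funext x; rw [← ht' j x]; ring
    rw [this]; fun_prop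
  have hsum := summable_windowCoeff hs hb ε y₀ 0
  set P := expSeries (windowCoeff b ε y₀ 0) (latticePoint ε) with hP
  have hPmem : P ∈ gevreySpace d s := expSeries_mem_gevreySpace (by linarith) hsum
  have hbs : Summable fun n : ℤ => ‖b (n - 0)‖ := by
    have h1 := (hb1 0 (1 / 2) (by norm_num)).summable.norm
    simpa only [norm_mul, norm_expNegI, mul_one] using h1
  have hP1 : ∀ x, (∀ j, |t j x - 1 / 2| ≤ 1 / 8) → P x = 1 := fun x hx => by
    have h1 := (hasSum_windowCoeff (b := b) (ε := ε) (y₀ := y₀) (ξ := 0) (x := x)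
      fun j => hb1 _ _ (hx j)).tsum_eq
    rw [hP, expSeries, h1, prod_expNegI_eq]
    simp [expFun]
  have hP0 : ∀ x, (∀ j, |t j x - 1 / 2| ≤ 1 / 2) → (∃ j, 1 / 4 ≤ |t j x - 1 / 2|) → P x = 0 := by
    rintro x hx ⟨j₀, hj₀⟩
    have h0 : ∀ j, Summable fun n : ℤ => b (n - ε.repr (0 : EuclideanSpace ℝ (Fin d)) j) *
        expNegI (2 * Real.pi * (n * (inner ℝ (x - y₀) (ε j) / (2 * Real.pi)))) := fun j => by
      refine Summable.of_norm ?_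
      simpa only [norm_mul, norm_expNegI, mul_one, map_zero, Finsupp.coe_zero, Pi.zero_apply]
        using hbs
    have h1 := (hasSum_windowCoeff (b := b) (ε := ε) (y₀ := y₀) (ξ := 0) (x := x)
      fun j => (h0 j).hasSum).tsum_eq
    rw [hP, expSeries, h1, Finset.prod_eq_zero (Finset.mem_univ j₀), mul_zero]
    exact (hb0 _ _ hj₀ (hx j₀)).tsum_eq
  -- `P` is periodic and one cell has to be cut out. The cut at 3/8 lies inside the zone between 1/4
  -- and 1/2 where `P` is zero, so no regularity is lost.
  set Q : Set (EuclideanSpace ℝ (Fin d)) := {x | ∀ j, |t j x - 1 / 2| < 3 / 8} with hQ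
  set χ : EuclideanSpace ℝ (Fin d) → ℂ := Q.indicator P with hχ
  have hopen : ∀ c : ℝ, IsOpen {x | ∀ j, |t j x - 1 / 2| < c} := fun c => by
    have : {x | ∀ j, |t j x - 1 / 2| < c} = ⋂ j, {x | |t j x - 1 / 2| < c} := by
      ext x; simp
    rw [this]
    exact isOpen_iInter_of_finite fun j =>
      isOpen_lt ((htc j).sub continuous_const).abs continuous_const
  have hQo : IsOpen Q := hopen _
  have hsupp : Function.support χ ⊆ Metric.closedBall x₀ (r / 2) := by
    intro x hx
    have hxQ : x ∈ Q := by
      by_contra h; exact hx (Set.indicator_of_notMem h _)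
    rw [Metric.mem_closedBall, dist_eq_norm]
    refine (norm_le_sum_abs _).trans ?_
    calc ∑ j, |(x - x₀) j| ≤ ∑ _j : Fin d, R * (3 / 8) := by
          refine Finset.sum_le_sum fun j _ => ?_
          have h1 := hxQ j
          rw [ht', abs_div, abs_of_pos hR0, div_lt_iff₀ hR0] at h1
          rw [PiLp.sub_apply]
          linarith
      _ = d / (d + 1) * (r * (3 / 8)) := by
          simp [hR]; field_simp
      _ ≤ 1 * (r * (3 / 8)) := by
          gcongr
          rw [div_le_one (by positivity)]; linarith
      _ ≤ r / 2 := by linarith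
  have hts : tsupport χ ⊆ Metric.closedBall x₀ (r / 2) :=
    closure_minimal hsupp Metric.isClosed_closedBall
  refine ⟨χ, mem_gevreySpace_of_eventuallyEq hPmem fun x => ?_,
    (isCompact_closedBall x₀ (r / 2)).of_isClosed_subset (isClosed_tsupport _) hts,
    hts.trans ((Metric.closedBall_subset_ball (by linarith)).trans hrV), ?_⟩
  · by_cases h1 : ∀ j, |t j x - 1 / 2| < 1 / 2
    · by_cases h2 : ∃ j, 1 / 4 < |t j x - 1 / 2|
      · right
        obtain ⟨j, hj⟩ := h2
        have h3 : ∀ᶠ y in 𝓝 x, 1 / 4 < |t j y - 1 / 2| :=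
          (isOpen_lt continuous_const ((htc j).sub continuous_const).abs).mem_nhds hj
        filter_upwards [h3, (hopen _).mem_nhds h1] with y hy hy'
        by_cases hyQ : y ∈ Q
        · rw [hχ, Set.indicator_of_mem hyQ, hP0 y (fun j => (hy' j).le) ⟨j, hy.le⟩]; rfl
        · rw [hχ, Set.indicator_of_notMem hyQ]; rfl
      · left
        push Not at h2
        have h3 : x ∈ Q := fun j => (h2 j).trans_lt (by norm_num)
        filter_upwards [hQo.mem_nhds h3] with y hy
        exact Set.indicator_of_mem hy _
    · right
      push Not at h1
      obtain ⟨j, hj⟩ := h1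
      have h3 : ∀ᶠ y in 𝓝 x, 3 / 8 < |t j y - 1 / 2| :=
        (isOpen_lt continuous_const ((htc j).sub continuous_const).abs).mem_nhds
          (lt_of_lt_of_le (by norm_num) hj)
      filter_upwards [h3] with y hy
      exact Set.indicator_of_notMem (fun h : y ∈ Q => absurd (h j) (not_lt.2 hy.le)) _
  · have h1 : ∀ j, |t j x₀ - 1 / 2| < 1 / 8 := fun j => by
      rw [ht']; simp
    filter_upwards [(hopen _).mem_nhds h1] with y hy
    have hyQ : y ∈ Q := fun j => (hy j).trans (by norm_num)
    rw [hχ, Set.indicator_of_mem hyQ, hP1 y fun j => (hy j).le]; rfl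

theorem GevreyDual.isClosed_support {s : ℝ} (f : GevreyDual d s) : IsClosed f.support := by
  rw [← isOpen_compl_iff, isOpen_iff_mem_nhds]
  intro x hx
  simp only [GevreyDual.support, Set.mem_compl_iff, Set.mem_ofPred_eq, not_forall] at hx
  obtain ⟨U, hU, hxU, h⟩ := hx
  filter_upwards [hU.mem_nhds hxU] with y hy hy'
  exact h (hy' U hU hy)

/-- The Fourier transform of an ultradistribution supported in the interior of a period cell is
recovered from its values on the dual lattice, with rapidly decaying coefficients. -/
theorem GevreyDual.exists_fourier_expansion {s : ℝ} (hs : 1 < s) (f : GevreyDual d s)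
    (hc : IsCompact f.support) (ε : Module.Basis (Fin d) ℝ (EuclideanSpace ℝ (Fin d)))
    (y₀ : EuclideanSpace ℝ (Fin d))
    (hsupp : ∀ x ∈ f.support, ∀ j, 0 < inner ℝ (x - y₀) (ε j) ∧
      inner ℝ (x - y₀) (ε j) < 2 * Real.pi) :
    ∃ B : EuclideanSpace ℝ (Fin d) → (Fin d → ℤ) → ℂ,
      (∀ h : ℝ, ∃ C : ℝ, 0 ≤ C ∧
        ∀ ξ n, ‖B ξ n‖ ≤ C * Real.exp (-h * ‖ξ - latticePoint ε n‖ ^ (1 / s))) ∧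
      ∀ ξ, HasSum (fun n => B ξ n * f.fourier hs (latticePoint ε n)) (f.fourier hs ξ) := by
  set t : Fin d → EuclideanSpace ℝ (Fin d) → ℝ :=
    fun j x => inner ℝ (x - y₀) (ε j) / (2 * Real.pi) with ht
  have htc : ∀ j, Continuous (t j) := fun j => by
    simp only [ht]; fun_prop
  have hlt : ∀ x ∈ f.support, ∀ j, |t j x - 1 / 2| < 1 / 2 := fun x hx j => by
    obtain ⟨h1, h2⟩ := hsupp x hx j
    have h3 : 0 < t j x := div_pos h1 Real.two_pi_pos
    have h4 : t j x < 1 := (div_lt_one Real.two_pi_pos).2 h2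
    rw [abs_lt]; constructor <;> linarith
  -- Compactness makes the strict inclusion in the cell uniform, which leaves room for the window
  -- radii `r < R < 1/2`.
  obtain ⟨ρ, hρ0, hρ, hρf⟩ : ∃ ρ : ℝ, 0 < ρ ∧ ρ < 1 / 2 ∧
      ∀ x ∈ f.support, ∀ j, |t j x - 1 / 2| ≤ ρ := by
    have h1 : ∀ j, ∃ ρ : ℝ, ρ < 1 / 2 ∧ ∀ x ∈ f.support, |t j x - 1 / 2| ≤ ρ := fun j => by
      rcases f.support.eq_empty_or_nonempty with h | h
      · exact ⟨0, by norm_num, by simp [h]⟩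
      · obtain ⟨x, hx, hmax⟩ := hc.exists_isMaxOn h
          (((htc j).sub (continuous_const (y := (1 / 2 : ℝ)))).abs).continuousOn
        exact ⟨_, hlt x hx j, fun y hy => hmax hy⟩
    choose ρ hρ hρf using h1
    rcases isEmpty_or_nonempty (Fin d) with he | hne
    · exact ⟨1 / 4, by norm_num, by norm_num, fun x _ j => he.elim j⟩
    · obtain ⟨j, hj⟩ := Finite.exists_max ρ
      refine ⟨max (ρ j) (1 / 4), lt_max_of_lt_right (by norm_num), max_lt (hρ j) (by norm_num),
        fun x hx i => (hρf i x hx).trans ((hj i).trans (le_max_left _ _))⟩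
  obtain ⟨r, hρr, hr⟩ := exists_between hρ
  obtain ⟨R, hrR, hR⟩ := exists_between hr
  obtain ⟨b, hb, hb1, -⟩ := exists_fourier_window hs (hρ0.trans hρr) hrR hR
  refine ⟨windowCoeff b ε y₀, exists_norm_windowCoeff_le hs hb ε y₀, fun ξ => ?_⟩
  have hsum := summable_windowCoeff hs hb ε y₀ ξ
  have hH := f.hasSum_expSeries hs hsum
  set P : gevreySpace d s := ⟨expSeries (windowCoeff b ε y₀ ξ) (latticePoint ε),
    expSeries_mem_gevreySpace (by linarith) hsum⟩ with hP
  -- The window equals 1 on a whole neighbourhood of the support, so there the series and the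
  -- exponential coincide.
  have h0 : f.toLinearMap (P - ⟨expFun ξ, expFun_mem_gevreySpace hs ξ⟩) = 0 := by
    refine f.apply_eq_zero hs (exists_gevrey_bump hs) _ fun x hx => ?_
    have h1 : ∀ᶠ y in 𝓝 x, ∀ j, |t j y - 1 / 2| < r :=
      eventually_all.2 fun j =>
        (isOpen_lt ((htc j).sub continuous_const).abs continuous_const).mem_nhds
          ((hρf x hx j).trans_lt hρr)
    filter_upwards [h1] with y hy
    have h2 := (hasSum_windowCoeff (b := b) (ε := ε) (y₀ := y₀) (ξ := ξ) (x := y)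
      fun j => hb1 _ _ (hy j).le).tsum_eq
    rw [prod_expNegI_eq] at h2
    simp [hP, expSeries, h2]
  rw [map_sub, sub_eq_zero] at h0
  rw [h0] at hH
  refine (hH.mul_left (((2 * Real.pi) ^ (-(d : ℝ) / 2) : ℝ) : ℂ)).of_eq (fun n => ?_) rfl
  rw [GevreyDual.fourier]
  ring

end window

/-! ### Young's inequality between a lattice and the whole space. -/

section lebesgue

variable {d : ℕ}

/-- The function `x ↦ exp(-‖x‖^{1/s})` with values in `[0, ∞]`. -/
noncomputable def expKernel (s : ℝ) (x : EuclideanSpace ℝ (Fin d)) : ℝ≥0∞ :=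
  ENNReal.ofReal (Real.exp (-‖x‖ ^ (1 / s)))

theorem measurable_expKernel (s : ℝ) :
    Measurable (expKernel s : EuclideanSpace ℝ (Fin d) → ℝ≥0∞) := by
  unfold expKernel; fun_prop

theorem expKernel_le_one {s : ℝ} (x : EuclideanSpace ℝ (Fin d)) : expKernel s x ≤ 1 := by
  rw [expKernel, ENNReal.ofReal_le_one, Real.exp_le_one_iff, neg_nonpos]
  positivity

theorem lintegral_expKernel_lt_top {s : ℝ} (hs : 1 < s) :
    ∫⁻ x : EuclideanSpace ℝ (Fin d), expKernel s x < ∞ := by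
  have hs0 : 0 < s := by linarith
  have hfin := finite_integral_one_add_norm (E := EuclideanSpace ℝ (Fin d)) (μ := volume)
    (r := ((d + 1 : ℕ) : ℝ)) (by rw [finrank_euclideanSpace_fin]; push_cast; linarith)
  set C : ℝ := Real.exp 1 * (((d + 1).factorial : ℝ) ^ s * (s ^ s) ^ (d + 1)) with hC
  have hle : ∀ x : EuclideanSpace ℝ (Fin d),
      expKernel s x ≤ ENNReal.ofReal C * ENNReal.ofReal ((1 + ‖x‖) ^ (-((d + 1 : ℕ) : ℝ))) := by
    intro x
    rw [expKernel, ← ENNReal.ofReal_mul (by positivity)]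
    refine ENNReal.ofReal_le_ofReal ?_
    have hf : (0 : ℝ) < (d + 1).factorial := by exact_mod_cast Nat.factorial_pos _
    have hx0 : 0 < 1 + ‖x‖ := by positivity
    -- Division by `s ^ s` turns the exponent into exactly `(1 + ‖x‖)^{1/s}`; the power `d + 1` is
    -- integrable at infinity.
    have h1 := pow_div_factorial_rpow_le hs0 (y := (1 + ‖x‖) / s ^ s) (by positivity) (d + 1)
    have e : s * ((1 + ‖x‖) / s ^ s) ^ (1 / s) = (1 + ‖x‖) ^ (1 / s) := by
      rw [Real.div_rpow hx0.le (by positivity), ← Real.rpow_mul hs0.le, mul_one_div_cancel hs0.ne',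
        Real.rpow_one]
      field_simp
    rw [e] at h1
    have h2 : (1 + ‖x‖) ^ (1 / s) ≤ 1 + ‖x‖ ^ (1 / s) := by
      simpa using rpow_inv_subadd hs zero_le_one (norm_nonneg x)
    have h3 := h1.trans (Real.exp_le_exp.2 h2)
    rw [Real.exp_add, div_pow, div_div, div_le_iff₀ (by positivity)] at h3
    rw [Real.rpow_neg hx0.le, Real.rpow_natCast, Real.exp_neg, ← div_eq_mul_inv,
      le_div_iff₀ (by positivity), inv_mul_le_iff₀ (Real.exp_pos _)]
    refine h3.trans_eq ?_
    rw [hC]; ring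
  refine (lintegral_mono hle).trans_lt ?_
  rw [lintegral_const_mul' _ _ ENNReal.ofReal_ne_top]
  exact ENNReal.mul_lt_top ENNReal.ofReal_lt_top hfin

theorem exists_tsum_expKernel_le {s : ℝ} (hs : 1 < s)
    (ε : Module.Basis (Fin d) ℝ (EuclideanSpace ℝ (Fin d))) :
    ∃ S : ℝ≥0∞, S ≠ ∞ ∧ ∀ ξ, ∑' n, expKernel s (ξ - latticePoint ε n) ≤ S := by
  obtain ⟨S, hS⟩ := exists_tsum_exp_neg_le hs ε
  refine ⟨ENNReal.ofReal S, ENNReal.ofReal_ne_top, fun ξ => ?_⟩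
  simp only [expKernel]
  rw [← ENNReal.ofReal_tsum_of_nonneg (fun _ => (Real.exp_pos _).le) (hS ξ).1]
  exact ENNReal.ofReal_le_ofReal (hS ξ).2

/-- Hölder's inequality with respect to the weights `w`, passed to the supremum over finite sums. -/
theorem ENNReal.tsum_mul_rpow_le {ι : Type*} {p : ℝ} (hp : 1 ≤ p) (w g : ι → ℝ≥0∞) :
    (∑' i, w i * g i) ^ p ≤ (∑' i, w i) ^ (p - 1) * ∑' i, w i * g i ^ p := by
  have hp0 : 0 < p := by linarith
  have h : ∑' i, w i * g i ≤ (∑' i, w i) ^ (1 - p⁻¹) * (∑' i, w i * g i ^ p) ^ p⁻¹ := by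
    rw [ENNReal.tsum_eq_iSup_sum]
    refine iSup_le fun F => (ENNReal.inner_le_weight_mul_Lp_of_nonneg F hp w g).trans ?_
    have : 0 ≤ 1 - p⁻¹ := by rw [sub_nonneg]; exact inv_le_one_of_one_le₀ hp
    gcongr <;> exact ENNReal.sum_le_tsum F
  refine (ENNReal.rpow_le_rpow h hp0.le).trans_eq ?_
  rw [ENNReal.mul_rpow_of_nonneg _ _ hp0.le, ← ENNReal.rpow_mul, ← ENNReal.rpow_mul,
    inv_mul_cancel₀ hp0.ne', ENNReal.rpow_one]
  congr 2
  field_simp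

/-- Young's inequality for the convolution of a sequence on a lattice with an integrable kernel. -/
theorem eLpNorm_lt_top_of_le_lattice_sum {s : ℝ} (hs : 1 < s) {q : ℝ≥0∞} (hq : 1 ≤ q)
    (ε : Module.Basis (Fin d) ℝ (EuclideanSpace ℝ (Fin d))) {Ω : Set (EuclideanSpace ℝ (Fin d))}
    (hΩ : MeasurableSet Ω) {F : EuclideanSpace ℝ (Fin d) → ℂ} {G : (Fin d → ℤ) → ℝ≥0∞}
    {C : ℝ≥0∞} (hC : C ≠ ∞)
    (hG : if q = ∞ then ⨆ n, G n < ∞ else ∑' n, G n ^ q.toReal < ∞)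
    (hF : ∀ ξ ∈ Ω, ‖F ξ‖ₑ ≤ C * (∑' n, expKernel s (ξ - latticePoint ε n) * G n + expKernel s ξ)) :
    eLpNorm F q (volume.restrict Ω) < ∞ := by
  obtain ⟨S, hS, hSle⟩ := exists_tsum_expKernel_le hs ε
  by_cases hqt : q = ∞
  · subst hqt
    rw [if_pos rfl] at hG
    rw [eLpNorm_exponent_top]
    have hfin : C * (S * (⨆ n, G n) + 1) < ∞ := ENNReal.mul_lt_top hC.lt_top
      (ENNReal.add_lt_top.2 ⟨ENNReal.mul_lt_top hS.lt_top hG, ENNReal.one_lt_top⟩)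
    refine lt_of_le_of_lt (essSup_le_of_ae_le _ ?_) hfin
    filter_upwards [ae_restrict_mem hΩ] with ξ hξ
    refine (hF ξ hξ).trans ?_
    gcongr
    · calc ∑' n, expKernel s (ξ - latticePoint ε n) * G n
          ≤ ∑' n, expKernel s (ξ - latticePoint ε n) * ⨆ n, G n := by
            refine ENNReal.tsum_le_tsum fun n => ?_
            gcongr
            exact le_iSup G n
        _ = (∑' n, expKernel s (ξ - latticePoint ε n)) * ⨆ n, G n := ENNReal.tsum_mul_right
        _ ≤ _ := by gcongr; exact hSle ξ
    · exact expKernel_le_one ξ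
  · rw [if_neg hqt] at hG
    have hq0 : q ≠ 0 := (zero_lt_one.trans_le hq).ne'
    set p := q.toReal with hp
    have hp1 : 1 ≤ p := by
      rw [hp, ← ENNReal.toReal_one]
      exact ENNReal.toReal_mono hqt hq
    have hp0 : 0 ≤ p := by linarith
    rw [eLpNorm_lt_top_iff_lintegral_rpow_enorm_lt_top hq0 hqt]
    have hI := lintegral_expKernel_lt_top (d := d) hs
    set I := ∫⁻ x : EuclideanSpace ℝ (Fin d), expKernel s x with hIdef
    set c : ℝ≥0∞ := C ^ p * 2 ^ (p - 1) with hc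
    have hcfin : c ≠ ∞ := ENNReal.mul_ne_top (ENNReal.rpow_ne_top_of_nonneg hp0 hC)
      (ENNReal.rpow_ne_top_of_nonneg (by linarith) (by simp))
    -- The factor `2 ^ (p - 1)` in `c` comes from the convexity bound for `(a + b)^p`; the separate
    -- kernel term, being at most 1, dominates its own `p`-th power.
    have hpt : ∀ ξ ∈ Ω, ‖F ξ‖ₑ ^ p ≤ c * (S ^ (p - 1) *
        ∑' n, expKernel s (ξ - latticePoint ε n) * G n ^ p + expKernel s ξ) := by
      intro ξ hξ
      refine (ENNReal.rpow_le_rpow (hF ξ hξ) hp0).trans ?_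
      rw [ENNReal.mul_rpow_of_nonneg _ _ hp0, hc, mul_assoc]
      refine mul_le_mul_right ((ENNReal.rpow_add_le_mul_rpow_add_rpow _ _ hp1).trans ?_) _
      refine mul_le_mul_right (add_le_add ?_ ?_) _
      · refine (ENNReal.tsum_mul_rpow_le hp1 _ _).trans ?_
        have : 0 ≤ p - 1 := by linarith
        gcongr
        exact hSle ξ
      · exact ENNReal.rpow_le_self_of_le_one (expKernel_le_one ξ) hp1
    have hm' : ∀ n, Measurable fun ξ : EuclideanSpace ℝ (Fin d) =>
        expKernel s (ξ - latticePoint ε n) := fun n =>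
      (measurable_expKernel s).comp (measurable_id.sub_const _)
    have hm : ∀ n, Measurable fun ξ : EuclideanSpace ℝ (Fin d) =>
        expKernel s (ξ - latticePoint ε n) * G n ^ p := fun n =>
      (hm' n).mul_const _
    have hint : ∀ n, ∫⁻ ξ, expKernel s (ξ - latticePoint ε n) * G n ^ p = I * G n ^ p := fun n => by
      rw [lintegral_mul_const _ (hm' n),
        lintegral_sub_right_eq_self (μ := volume) (fun ξ => expKernel s ξ)]
    calc ∫⁻ ξ in Ω, ‖F ξ‖ₑ ^ p
        ≤ ∫⁻ ξ in Ω, c * (S ^ (p - 1) *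
          ∑' n, expKernel s (ξ - latticePoint ε n) * G n ^ p + expKernel s ξ) :=
          setLIntegral_mono' hΩ hpt
      _ ≤ ∫⁻ ξ, c * (S ^ (p - 1) *
          ∑' n, expKernel s (ξ - latticePoint ε n) * G n ^ p + expKernel s ξ) :=
          setLIntegral_le_lintegral _ _
      _ = c * (S ^ (p - 1) * (I * ∑' n, G n ^ p) + I) := by
          rw [lintegral_const_mul' _ _ hcfin, lintegral_add_right _ (measurable_expKernel s),
            lintegral_const_mul' _ _ (ENNReal.rpow_ne_top_of_nonneg (by linarith) hS),
            lintegral_tsum fun n => (hm n).aemeasurable, tsum_congr hint,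
            ENNReal.tsum_mul_left]
      _ < ∞ := by
          refine ENNReal.mul_lt_top hcfin.lt_top (ENNReal.add_lt_top.2 ⟨?_, hI⟩)
          exact ENNReal.mul_lt_top (ENNReal.rpow_lt_top_of_nonneg (by linarith) hS)
            (ENNReal.mul_lt_top hI hG)

end lebesgue

/-! ### Separation of cones. -/

section cones

variable {d : ℕ}

/-- The unit vectors in the closure of `Γ₀` form a compact set disjoint from the closed complement
of `Γ`, hence at positive distance from it; dividing `ξ` and `η` by `‖ξ‖` reduces to this case. -/
theorem exists_cone_separation {Γ₀ Γ : Set (EuclideanSpace ℝ (Fin d))} (hΓ₀ : IsOpenCone Γ₀)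
    (hΓ : IsOpenCone Γ) (h : closure Γ₀ \ {0} ⊆ Γ) :
    ∃ δ : ℝ, 0 < δ ∧ ∀ ξ ∈ Γ₀, ∀ η ∉ Γ, δ * ‖ξ‖ ≤ ‖ξ - η‖ := by
  have hc : IsCompact (closure Γ₀ ∩ Metric.sphere (0 : EuclideanSpace ℝ (Fin d)) 1) :=
    (isCompact_sphere _ _).inter_left isClosed_closure
  obtain ⟨r, hr, hsep⟩ := Metric.exists_pos_forall_lt_edist hc hΓ.1.isClosed_compl
    (Set.disjoint_left.2 fun x hx hx' => hx' (h ⟨hx.1, by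
      rintro rfl
      simpa using hx.2⟩))
  refine ⟨r, hr, fun ξ hξ η hη => ?_⟩
  rcases eq_or_ne ξ 0 with rfl | h0
  · simp
  have hn : 0 < ‖ξ‖ := norm_pos_iff.2 h0
  have h1 := hsep (‖ξ‖⁻¹ • ξ) ⟨subset_closure (hΓ₀.2 _ (inv_pos.2 hn) ξ hξ), by
    rw [mem_sphere_zero_iff_norm, norm_smul, norm_inv, norm_norm, inv_mul_cancel₀ hn.ne']⟩
    (‖ξ‖⁻¹ • η) (fun h' => hη (by
      have := hΓ.2 ‖ξ‖ hn _ h'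
      rwa [smul_smul, mul_inv_cancel₀ hn.ne', one_smul] at this))
  rw [edist_dist, dist_eq_norm, ← smul_sub, norm_smul, norm_inv, norm_norm,
    ← ENNReal.ofReal_coe_nnreal, ENNReal.ofReal_lt_ofReal_iff_of_nonneg r.coe_nonneg,
    inv_mul_eq_div, lt_div_iff₀ hn] at h1
  exact h1.le

end cones

/-! ### The weighted estimate, dual lattices and the conclusion. -/

section main

variable {d : ℕ}

/-- The estimate for the Fourier transform on a cone by its values at lattice points in a larger
cone, from an expansion with rapidly decaying coefficients. -/
theorem contSeminorm_lt_top_of_expansion {s : ℝ} (hs : 1 < s) {q : ℝ≥0∞} (hq : 1 ≤ q)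
    (f : GevreyDual d s) (ε : Module.Basis (Fin d) ℝ (EuclideanSpace ℝ (Fin d)))
    {Λ : Submodule ℤ (EuclideanSpace ℝ (Fin d))} (hΛ : ∀ n, latticePoint ε n ∈ Λ)
    {B : EuclideanSpace ℝ (Fin d) → (Fin d → ℤ) → ℂ}
    (hB : ∀ h : ℝ, ∃ C : ℝ, 0 ≤ C ∧
        ∀ ξ n, ‖B ξ n‖ ≤ C * Real.exp (-h * ‖ξ - latticePoint ε n‖ ^ (1 / s)))
    (hexp : ∀ ξ, HasSum (fun n => B ξ n * f.fourier hs (latticePoint ε n)) (f.fourier hs ξ))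
    {Γ₀ Γ : Set (EuclideanSpace ℝ (Fin d))} (hΓ₀ : IsOpenCone Γ₀)
    (hΓ : IsOpenCone Γ) (hΓ₀Γ : closure Γ₀ \ {0} ⊆ Γ) {ω : EuclideanSpace ℝ (Fin d) → ℝ}
    (hω : ∀ x, 0 ≤ ω x) {C k : ℝ} (hC : 0 ≤ C) (hk : 0 ≤ k)
    (hωk : ∀ x y, ω (x + y) ≤ C * Real.exp (k * ‖x‖ ^ (1 / s)) * ω y)
    (hdisc : discSeminorm hs q ω (Γ ∩ Λ) f < ∞) : contSeminorm hs q ω Γ₀ f < ∞ := by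
  classical
  have hs0 : 0 < s := by linarith
  obtain ⟨δ, hδ, hsep⟩ := exists_cone_separation hΓ₀ hΓ hΓ₀Γ
  obtain ⟨Cf, k₀, hCf, hk₀, hgrow⟩ := f.norm_fourier_le hs
  set D : ℝ := (δ⁻¹) ^ (1 / s) with hD
  have hD0 : 0 ≤ D := by positivity
  -- Write `y = ‖ξ - η‖^{1/s}`. For `η ∈ Γ` the part `k + 1` covers the weight and leaves `exp(-y)`.
  -- For `η ∉ Γ` one has `‖ξ‖^{1/s} ≤ D y` and `‖η‖^{1/s} ≤ (1 + D) y`, so the other parts cover the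
  -- growth rates `k` of `ω` and `k₀` of `f̂` and leave unit decay in both `ξ` and `η`.
  obtain ⟨Cb, hCb, hBb⟩ := hB (k + 1 + (k + 1) * D + (k₀ + 1) * (1 + D))
  set G : (Fin d → ℤ) → ℝ≥0∞ := fun n => if latticePoint ε n ∈ Γ then
    ‖f.fourier hs (latticePoint ε n) * (ω (latticePoint ε n) : ℂ)‖ₑ else 0 with hG
  obtain ⟨S, hS, hSle⟩ := exists_tsum_expKernel_le hs ε
  have hS0 : ∑' n, expKernel s (latticePoint ε n) ≤ S := by
    refine (tsum_congr fun n => ?_).trans_le (hSle 0)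
    simp only [expKernel, zero_sub, norm_neg]
  set C₁ : ℝ := Cb * C with hC₁
  set C₂ : ℝ := Cb * Cf * C * ω 0 with hC₂
  have hC₂0 : 0 ≤ C₂ := mul_nonneg (by positivity) (hω 0)
  have hin : ∀ ξ n, latticePoint ε n ∈ Γ →
      ‖B ξ n‖ * ‖f.fourier hs (latticePoint ε n)‖ * ω ξ ≤
        C₁ * (Real.exp (-‖ξ - latticePoint ε n‖ ^ (1 / s)) *
          (‖f.fourier hs (latticePoint ε n)‖ * ω (latticePoint ε n))) := by
    intro ξ n _
    set η := latticePoint ε n with hη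
    set y := ‖ξ - η‖ ^ (1 / s) with hy
    have hy0 : 0 ≤ y := by positivity
    have h1 := hωk (ξ - η) η
    rw [sub_add_cancel] at h1
    have hω' := hω η
    calc _ ≤ (Cb * Real.exp (-(k + 1 + (k + 1) * D + (k₀ + 1) * (1 + D)) * y)) *
          ‖f.fourier hs η‖ * (C * Real.exp (k * y) * ω η) := by
          have := hω ξ
          gcongr
          exact hBb ξ n
      _ = C₁ * (Real.exp (-(k + 1 + (k + 1) * D + (k₀ + 1) * (1 + D)) * y + k * y) *
          (‖f.fourier hs η‖ * ω η)) := by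
          rw [Real.exp_add, hC₁]; ring
      _ ≤ _ := by
          gcongr
          have : 0 ≤ ((k + 1) * D + (k₀ + 1) * (1 + D)) * y := by positivity
          linarith
  have hout : ∀ ξ ∈ Γ₀, ∀ n, latticePoint ε n ∉ Γ →
      ‖B ξ n‖ * ‖f.fourier hs (latticePoint ε n)‖ * ω ξ ≤
        C₂ * (Real.exp (-‖ξ‖ ^ (1 / s)) * Real.exp (-‖latticePoint ε n‖ ^ (1 / s))) := by
    intro ξ hξ n hn
    set η := latticePoint ε n with hη
    set y := ‖ξ - η‖ ^ (1 / s) with hy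
    have hy0 : 0 ≤ y := by positivity
    have h1 := hωk ξ 0
    rw [add_zero] at h1
    have hξy : ‖ξ‖ ^ (1 / s) ≤ D * y := by
      rw [hD, hy, ← Real.mul_rpow (by positivity) (norm_nonneg _)]
      refine Real.rpow_le_rpow (norm_nonneg _) ?_ (by positivity)
      rw [le_inv_mul_iff₀ hδ]
      exact hsep ξ hξ η hn
    have hηy : ‖η‖ ^ (1 / s) ≤ (1 + D) * y := by
      have h2 := norm_rpow_add_le hs (η - ξ) ξ
      rw [sub_add_cancel, norm_sub_rev] at h2
      linarith
    have hω0 := hω 0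
    have hω' := hω ξ
    calc _ ≤ (Cb * Real.exp (-(k + 1 + (k + 1) * D + (k₀ + 1) * (1 + D)) * y)) *
          (Cf * Real.exp (k₀ * ‖η‖ ^ (1 / s))) * (C * Real.exp (k * ‖ξ‖ ^ (1 / s)) * ω 0) := by
          have h2 := hBb ξ n
          have h3 := hgrow η
          gcongr
      _ = C₂ * Real.exp (-(k + 1 + (k + 1) * D + (k₀ + 1) * (1 + D)) * y +
          k₀ * ‖η‖ ^ (1 / s) + k * ‖ξ‖ ^ (1 / s)) := by
          rw [Real.exp_add, Real.exp_add, hC₂]; ring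
      _ ≤ C₂ * Real.exp (-‖ξ‖ ^ (1 / s) + -‖η‖ ^ (1 / s)) := by
          refine mul_le_mul_of_nonneg_left (Real.exp_le_exp.2 ?_) hC₂0
          have h2 := mul_le_mul_of_nonneg_left hξy (by linarith : 0 ≤ k + 1)
          have h3 := mul_le_mul_of_nonneg_left hηy (by linarith : 0 ≤ k₀ + 1)
          have h4 : 0 ≤ (k + 1) * y := by positivity
          linarith
      _ = _ := by rw [Real.exp_add]
  have hterm : ∀ ξ ∈ Γ₀, ∀ n, ‖B ξ n * f.fourier hs (latticePoint ε n) * (ω ξ : ℂ)‖ₑ ≤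
      ENNReal.ofReal C₁ * (expKernel s (ξ - latticePoint ε n) * G n) +
        ENNReal.ofReal C₂ * (expKernel s ξ * expKernel s (latticePoint ε n)) := by
    intro ξ hξ n
    have e : ‖B ξ n * f.fourier hs (latticePoint ε n) * (ω ξ : ℂ)‖ₑ =
        ENNReal.ofReal (‖B ξ n‖ * ‖f.fourier hs (latticePoint ε n)‖ * ω ξ) := by
      rw [← ofReal_norm, norm_mul, norm_mul, Complex.norm_real, Real.norm_eq_abs,
        abs_of_nonneg (hω ξ)]
    rw [e]
    by_cases hn : latticePoint ε n ∈ Γ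
    · refine le_add_right ((ENNReal.ofReal_le_ofReal (hin ξ n hn)).trans_eq ?_)
      simp only [hG, if_pos hn]
      rw [ENNReal.ofReal_mul (by positivity), ENNReal.ofReal_mul (Real.exp_pos _).le, expKernel,
        ← ofReal_norm, norm_mul, Complex.norm_real, Real.norm_eq_abs, abs_of_nonneg (hω _)]
    · refine le_add_left ((ENNReal.ofReal_le_ofReal (hout ξ hξ n hn)).trans_eq ?_)
      rw [ENNReal.ofReal_mul hC₂0, ENNReal.ofReal_mul (Real.exp_pos _).le, expKernel, expKernel]
  set A : ℝ≥0∞ := max (ENNReal.ofReal C₁) (ENNReal.ofReal C₂ * S) with hA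
  have hAtop : A ≠ ∞ := (max_lt ENNReal.ofReal_lt_top
    (ENNReal.mul_lt_top ENNReal.ofReal_lt_top hS.lt_top)).ne
  refine eLpNorm_lt_top_of_le_lattice_sum hs hq ε hΓ₀.1.measurableSet hAtop (G := G) ?_ ?_
  · have hmem : ∀ n : {n : Fin d → ℤ // latticePoint ε n ∈ Γ},
        latticePoint ε n.1 ∈ Γ ∩ (Λ : Set (EuclideanSpace ℝ (Fin d))) := fun n => ⟨n.2, hΛ n.1⟩
    unfold discSeminorm at hdisc
    split_ifs at hdisc ⊢ with hqt
    · refine lt_of_le_of_lt (iSup_le fun n => ?_) hdisc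
      simp only [hG]
      split_ifs with hn
      · exact le_iSup₂_of_le (f := fun ξ (_ : ξ ∈ Γ ∩ (Λ : Set (EuclideanSpace ℝ (Fin d)))) =>
          ‖f.fourier hs ξ * (ω ξ : ℂ)‖ₑ) (latticePoint ε n) (hmem ⟨n, hn⟩) le_rfl
      · exact zero_le
    · have hq0 : q ≠ 0 := (zero_lt_one.trans_le hq).ne'
      have hp : 0 < q.toReal := ENNReal.toReal_pos hq0 hqt
      have h1 := (ENNReal.rpow_lt_top_iff_of_pos (by positivity)).1 hdisc
      refine lt_of_le_of_lt ?_ h1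
      have h2 : ∑' n, G n ^ q.toReal = ∑' n : {n : Fin d → ℤ | latticePoint ε n ∈ Γ},
          ‖f.fourier hs (latticePoint ε n.1) * (ω (latticePoint ε n.1) : ℂ)‖ₑ ^ q.toReal := by
        rw [tsum_subtype {n : Fin d → ℤ | latticePoint ε n ∈ Γ} fun n =>
          ‖f.fourier hs (latticePoint ε n) * (ω (latticePoint ε n) : ℂ)‖ₑ ^ q.toReal]
        refine tsum_congr fun n => ?_
        simp only [hG]
        by_cases hn : latticePoint ε n ∈ Γ
        · rw [if_pos hn, Set.indicator_of_mem (by exact hn)]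
        · rw [if_neg hn, Set.indicator_of_notMem (by exact hn), ENNReal.zero_rpow_of_pos hp]
      rw [h2]
      refine ENNReal.tsum_comp_le_tsum_of_injective
        (f := fun n : {n : Fin d → ℤ | latticePoint ε n ∈ Γ} =>
          (⟨latticePoint ε n.1, hmem n⟩ : (Γ ∩ Λ : Set (EuclideanSpace ℝ (Fin d))))) ?_
        (fun ξ => ‖f.fourier hs (ξ : EuclideanSpace ℝ (Fin d)) * (ω ξ : ℂ)‖ₑ ^ q.toReal)
      intro n m h
      exact Subtype.ext (latticePoint_injective ε (congrArg Subtype.val h))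
  · intro ξ hξ
    rw [← ((hexp ξ).mul_right (ω ξ : ℂ)).tsum_eq]
    refine enorm_tsum_le_tsum_enorm.trans ((ENNReal.tsum_le_tsum (hterm ξ hξ)).trans ?_)
    rw [ENNReal.tsum_add, ENNReal.tsum_mul_left, ENNReal.tsum_mul_left, ENNReal.tsum_mul_left,
      mul_add]
    refine add_le_add ?_ ?_
    · gcongr; exact le_max_left _ _
    · calc _ ≤ ENNReal.ofReal C₂ * (expKernel s ξ * S) := by gcongr
        _ = ENNReal.ofReal C₂ * S * expKernel s ξ := by ring
        _ ≤ _ := by gcongr; exact le_max_right _ _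

/-- Needed because the edges of `D₁` may form another basis of `Λ₁` than the one given with the
admissible pair. -/
theorem exists_dual_basis (e : Module.Basis (Fin d) ℝ (EuclideanSpace ℝ (Fin d))) {c : ℝ}
    (hc : c ≠ 0) : ∃ ε : Module.Basis (Fin d) ℝ (EuclideanSpace ℝ (Fin d)),
      ∀ j k, inner ℝ (e j) (ε k) = if j = k then c else 0 := by
  have hB : (innerₗ (EuclideanSpace ℝ (Fin d))).Nondegenerate :=
    ⟨fun x h => inner_self_eq_zero.1 (h x), fun x h => inner_self_eq_zero.1 (h x)⟩
  refine ⟨(LinearMap.BilinForm.dualBasis (innerₗ (EuclideanSpace ℝ (Fin d))) hB e).isUnitSMul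
    fun _ => IsUnit.mk0 c hc, fun j k => ?_⟩
  have h := LinearMap.BilinForm.apply_dualBasis_left hB e k j
  rw [innerₗ_apply_apply] at h
  rw [Module.Basis.isUnitSMul_apply, real_inner_smul_right, real_inner_comm, h]
  simp

/-- Computing `⟨e_i, ε'_k⟩` in two ways shows that the `i`-th coordinate of `ε'_k` in `ε` is the
`k`-th coordinate of `e_i` in `e'`, an integer because `e` and `e'` span the same lattice. -/
theorem latticePoint_mem_of_dual {Λ₁ Λ₂ : Submodule ℤ (EuclideanSpace ℝ (Fin d))}
    {e e' ε ε' : Module.Basis (Fin d) ℝ (EuclideanSpace ℝ (Fin d))} (he : IsLatticeBasis Λ₁ e)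
    (he' : IsLatticeBasis Λ₁ e') (hε : IsLatticeBasis Λ₂ ε) {c : ℝ} (hc : c ≠ 0)
    (h : ∀ j k, inner ℝ (e j) (ε k) = if j = k then c else 0)
    (h' : ∀ j k, inner ℝ (e' j) (ε' k) = if j = k then c else 0) (n : Fin d → ℤ) :
    latticePoint ε' n ∈ Λ₂ := by
  have hmem : ∀ k, ε' k ∈ Λ₂ := by
    intro k
    rw [hε, Module.Basis.mem_span_iff_repr_mem]
    intro i
    have hi : e i ∈ Submodule.span ℤ (Set.range e') := by
      rw [← he', he]; exact Submodule.subset_span ⟨i, rfl⟩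
    obtain ⟨m, hm⟩ := (Module.Basis.mem_span_iff_repr_mem ℤ e' (e i)).1 hi k
    refine ⟨m, ?_⟩
    have h1 : inner ℝ (e i) (ε' k) = c * e'.repr (e i) k := by
      conv_lhs => rw [← e'.sum_repr (e i)]
      rw [sum_inner, Finset.sum_eq_single k]
      · rw [real_inner_smul_left, h', if_pos rfl, mul_comm]
      · intro j _ hj; rw [real_inner_smul_left, h', if_neg hj, mul_zero]
      · simp
    have h2 : inner ℝ (e i) (ε' k) = c * ε.repr (ε' k) i := by
      conv_lhs => rw [← ε.sum_repr (ε' k)]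
      rw [inner_sum, Finset.sum_eq_single i]
      · rw [real_inner_smul_right, h, if_pos rfl, mul_comm]
      · intro j _ hj; rw [real_inner_smul_right, h, if_neg hj.symm, mul_zero]
      · simp
    rw [hm]
    exact mul_left_cancel₀ hc (h1.symm.trans h2)
  rw [latticePoint]
  refine Submodule.sum_mem _ fun j _ => ?_
  rw [Int.cast_smul_eq_zsmul]
  exact Λ₂.smul_mem _ (hmem j)

/-- A point of an open subset of a parallelepiped has coordinates strictly between the extreme
ones. -/
theorem inner_mem_Ioo_of_mem_open {e ε : Module.Basis (Fin d) ℝ (EuclideanSpace ℝ (Fin d))}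
    {c : ℝ} (hc : 0 < c) (h : ∀ j k, inner ℝ (e j) (ε k) = if j = k then c else 0)
    {x₀ x : EuclideanSpace ℝ (Fin d)} {U : Set (EuclideanSpace ℝ (Fin d))} (hU : IsOpen U)
    (hUD : U ⊆ (fun y => x₀ + y) '' parallelepiped e) (hx : x ∈ U) (j : Fin d) :
    0 < inner ℝ (x - x₀) (ε j) ∧ inner ℝ (x - x₀) (ε j) < c := by
  have hIcc : ∀ y ∈ U, 0 ≤ inner ℝ (y - x₀) (ε j) ∧ inner ℝ (y - x₀) (ε j) ≤ c := by
    intro y hy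
    obtain ⟨z, hz, rfl⟩ := hUD hy
    obtain ⟨t, ht, rfl⟩ := (mem_parallelepiped_iff _ _).1 hz
    have : inner ℝ (x₀ + ∑ i, t i • e i - x₀) (ε j) = t j * c := by
      rw [add_sub_cancel_left, sum_inner, Finset.sum_eq_single j]
      · rw [real_inner_smul_left, h, if_pos rfl]
      · intro i _ hi; rw [real_inner_smul_left, h, if_neg hi, mul_zero]
      · simp
    rw [this]
    have h0 := ht.1 j
    have h1 := ht.2 j
    simp only [Pi.zero_apply, Pi.one_apply] at h0 h1
    exact ⟨by positivity, mul_le_of_le_one_left hc.le h1⟩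
  -- A small move along `± e j` stays in `U` and changes the coordinate by `± r c / 2`; the closed
  -- bounds at both ends make those at `x` strict.
  have hcont : Continuous fun τ : ℝ => x + τ • e j := by fun_prop
  have hnh : ∀ᶠ τ in 𝓝 (0 : ℝ), x + τ • e j ∈ U :=
    hcont.continuousAt.eventually_mem (by simpa using hU.mem_nhds hx)
  obtain ⟨r, hr, hball⟩ := Metric.eventually_nhds_iff.1 hnh
  have hval : ∀ τ : ℝ, inner ℝ (x + τ • e j - x₀) (ε j) = inner ℝ (x - x₀) (ε j) + τ * c := by
    intro τ
    rw [add_sub_right_comm, inner_add_left, real_inner_smul_left, h, if_pos rfl]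
  have h1 := hIcc _ (hball (y := r / 2) (by
    rw [Real.dist_eq, sub_zero, abs_of_pos (by positivity)]; linarith))
  have h2 := hIcc _ (hball (y := -(r / 2)) (by
    rw [Real.dist_eq, sub_zero, abs_neg, abs_of_pos (by positivity)]; linarith))
  rw [hval] at h1 h2
  have : 0 < r / 2 * c := by positivity
  constructor <;> linarith

end main

theorem lemma4p2 {d : ℕ} {s : ℝ} (hs : 1 < s) (q : ℝ≥0∞) (hq : 1 ≤ q)
    (Λ₁ Λ₂ : Submodule ℤ (EuclideanSpace ℝ (Fin d))) (hΛ : IsAdmissibleLatticePair Λ₁ Λ₂)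
    (D₁ : Set (EuclideanSpace ℝ (Fin d))) (hD₁ : IsLatticeParallelepiped Λ₁ D₁)
    (f : GevreyDual d s)
    (hf : ∃ U : Set (EuclideanSpace ℝ (Fin d)), IsOpen U ∧ f.support ⊆ U ∧ U ⊆ D₁)
    (Γ₀ Γ : Set (EuclideanSpace ℝ (Fin d))) (hΓ₀ : IsOpenCone Γ₀) (hΓ : IsOpenCone Γ)
    -- the closure is taken in `ℝ^d ∖ {0}`
    (hΓ₀Γ : closure Γ₀ \ {0} ⊆ Γ) :
    -- weights on `ℝ^d`
    (∀ ω : EuclideanSpace ℝ (Fin d) → ℝ, IsModerateWeight s ω →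
      discSeminorm hs q ω (Γ ∩ Λ₂) f < ∞ → contSeminorm hs q ω Γ₀ f < ∞) ∧
    -- weights on `ℝ^{2d}`, frozen at a point `x`
    (∀ ω : EuclideanSpace ℝ (Fin d) → EuclideanSpace ℝ (Fin d) → ℝ,
      IsModerateWeight s (fun p : WithLp 2 (EuclideanSpace ℝ (Fin d) × EuclideanSpace ℝ (Fin d)) =>
        ω p.fst p.snd) →
      ∀ x : EuclideanSpace ℝ (Fin d),
        discSeminorm hs q (ω x) (Γ ∩ Λ₂) f < ∞ → contSeminorm hs q (ω x) Γ₀ f < ∞) := by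
  obtain ⟨e, ε, he, hε, c, hc, hc2, hdual⟩ := hΛ
  obtain ⟨x₀, -, e', he', rfl⟩ := hD₁
  obtain ⟨U, hU, hfU, hUD⟩ := hf
  obtain ⟨ε', hdual'⟩ := exists_dual_basis e' hc.ne'
  have hmem := latticePoint_mem_of_dual he he' hε hc.ne' hdual hdual'
  have hcompact : IsCompact f.support := by
    have h1 : IsCompact ((fun y => x₀ + y) '' parallelepiped e') := by
      rw [← e'.coe_parallelepiped]
      exact e'.parallelepiped.isCompact.image (by fun_prop)
    exact h1.of_isClosed_subset f.isClosed_support (hfU.trans hUD)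
  obtain ⟨B, hB, hexp⟩ := f.exists_fourier_expansion hs hcompact ε' x₀ fun x hx j => by
    have := inner_mem_Ioo_of_mem_open hc hdual' hU hUD (hfU hx) j
    -- The bound `c ≤ 2π` enters here: it fits `D₁` into one period cell.
    exact ⟨this.1, this.2.trans_le hc2⟩
  constructor
  · rintro ω ⟨hω, v, -, -, ⟨C, k, hC, hk, hv⟩, C', hC', hωv⟩ hdisc
    refine contSeminorm_lt_top_of_expansion hs hq f ε' hmem hB hexp hΓ₀ hΓ hΓ₀Γ hω
      (C := C' * C) (k := k) (by positivity) hk.le (fun x y => ?_) hdisc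
    refine (hωv x y).trans (mul_le_mul_of_nonneg_right ?_ (hω y))
    rw [mul_assoc]
    exact mul_le_mul_of_nonneg_left (hv x) hC'.le
  · rintro ω ⟨hω, v, -, -, ⟨C, k, hC, hk, hv⟩, C', hC', hωv⟩ x hdisc
    have hωx : ∀ y, 0 ≤ ω x y := fun y => hω (WithLp.toLp 2 (x, y))
    refine contSeminorm_lt_top_of_expansion hs hq f ε' hmem hB hexp hΓ₀ hΓ hΓ₀Γ hωx
      (C := C' * C) (k := k) (by positivity) hk.le (fun y z => ?_) hdisc
    -- Increments in the second variable alone leave `x` frozen, so `ω x` is moderate with constants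
    -- independent of `x`.
    have h1 := hωv (WithLp.toLp 2 (0, y)) (WithLp.toLp 2 (x, z))
    have h2 := hv (WithLp.toLp 2 (0, y))
    rw [WithLp.norm_toLp_snd] at h2
    have h3 : ω x (y + z) ≤ C' * v (WithLp.toLp 2 (0, y)) * ω x z := by
      simpa using h1
    refine h3.trans (mul_le_mul_of_nonneg_right ?_ (hωx z))
    rw [mul_assoc]
    exact mul_le_mul_of_nonneg_left h2 hC'.le
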